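/- Let $G$ be an $n$-dimensional real matrix Lie group, i.e. a Lie group realised as a Lie subgroup of $GL(m,\mathbb{R})$, with Lie algebra $\mathfrak{g}=T_eG\subset\mathbb{R}^{m\times m}$. Let $\tilde E_1,\dots,\tilde E_n$ be a basis of $\mathfrak{g}$ and $\Lambda:\mathbb{R}^n\to\mathfrak{g}$, $\Lambda(x)=\sum_i x^i\tilde E_i$. For $\tilde A\in\mathfrak{g}$ let $\mathrm{ad}_{\tilde A}\in\mathbb{R}^{n\times n}$ be the matrix of $x\mapsto\Lambda^{-1}\big(\tilde A\Lambda(x)-\Lambda(x)\tilde A\big)$. For $V\in C^1(G,\mathbb{R})$ let $\mathrm{d}_gV\in\mathbb{R}^n$ be the left-trivialized gradient, i.e. the vector whose $i$-th entry is $\mathrm{d}V(g)$ applied to the tangent vector $g\tilde E_i\in T_gG$ (equivalently $\mathrm{d}_gV=\frac{\partial}{\partial q}V\big(g\exp(\Lambda(q))\big)\big|_{q=0}$). Let $f:G\times\mathbb{R}\times\mathbb{R}^{p}\to\mathbb{R}^{m\times m}$, $(g,t,\theta)\mapsto f_\theta(g,t)$, be $C^1$ with $f_\theta(g,t)\in T_gG$,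 and put $\tilde f_\theta(g,t)=g^{-1}f_\theta(g,t)\in\mathfrak{g}$. Let $F:G\times\mathbb{R}^p\to\mathbb{R}$ and $r:G\times\mathbb{R}^p\times\mathbb{R}\to\mathbb{R}$ be $C^1$, let $T\ge 0$ and $g_0\in G$, and suppose that for every $\theta$ the equation $\dot g=f_\theta(g,t)$, $g(0)=g_0$, has a solution on $[0,T]$, denoted $t\mapsto\Psi^t_{f_\theta}(g_0)$. Define the cost $$C^T_{f_\theta}(g_0,\theta)=F\big(\Psi^T_{f_\theta}(g_0),\theta\big)+\int_0^T r\big(\Psi^s_{f_\theta}(g_0),\theta,s\big)\,\mathrm{d}s .$$ Then for every $\theta\in\mathbb{R}^p$ the system $$\dot g=f_\theta(g,t),\quad g(0)=g_0,$$ $$\dot\lambda_g=-\mathrm{d}_g\big(\lambda_g^\top\Lambda^{-1}(\tilde f_\theta)+r\big)+\mathrm{ad}_{\tilde f_\theta}^\top\lambda_g,\quad \lambda_g(T)=\mathrm{d}_gF$$ (where $\lambda_g$ is held fixed when $\mathrm{d}_g$ is applied, $\tilde f_\theta$ and $r$ are taken along $(g(t),t,\theta)$, and $\mathrm{d}_gF$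 is taken at $g(T)$) has exactly one solution $g:[0,T]\to G$, $\lambda_g:[0,T]\to\mathbb{R}^n$. The cost is differentiable in $\theta$, the integrand below is integrable on $[0,T]$, and $$\frac{\partial}{\partial\theta}C^T_{f_\theta}(g_0,\theta)=\frac{\partial F}{\partial\theta}\big(g(T),\theta\big)+\int_0^T\Big[\frac{\partial}{\partial\theta}\big(\lambda_g^\top\Lambda^{-1}(\tilde f_\theta)\big)+\frac{\partial r}{\partial\theta}\Big]\mathrm{d}t ,$$ where in the integrand $g=g(t)$ and $\lambda_g=\lambda_g(t)$ are held fixed under $\partial/\partial\theta$. -/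

import Mathlib

open scoped Manifold ContDiff Matrix Matrix.Norms.L2Operator
open Set

noncomputable section

namespace LieAdjoint

/-- A group homomorphism into `GL(m, ℝ)`, read as a map into the `m × m` matrices. -/
def toMat {m : ℕ} {H : Type*} [Group H] (ι : H →* GL (Fin m) ℝ) (g : H) : Matrix (Fin m) (Fin m) ℝ :=
  (ι g : Matrix (Fin m) (Fin m) ℝ)

theorem toMat_one {m : ℕ} {H : Type*} [Group H] (ι : H →* GL (Fin m) ℝ) : toMat ι 1 = 1 := by simp [toMat]

theorem toMat_mul {m : ℕ} {H : Type*} [Group H] (ι : H →* GL (Fin m) ℝ) (g h : H) :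
    toMat ι (g * h) = toMat ι g * toMat ι h := by simp [toMat]

theorem toMat_mul_inv {m : ℕ} {H : Type*} [Group H] (ι : H →* GL (Fin m) ℝ) (g : H) :
    toMat ι g * toMat ι g⁻¹ = 1 := by
  rw [← toMat_mul, mul_inv_cancel, toMat_one]

variable {n m p : ℕ} {G : Type*} [TopologicalSpace G]
  [ChartedSpace (EuclideanSpace ℝ (Fin n)) G] [Group G]

/-- The Lie group `G` is a matrix Lie group through `ι`: it is a Lie subgroup of `GL(m, ℝ)`, that
is, `ι` is a smooth injective group homomorphism and an immersion. (Closed subgroups of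
`GL(m, ℝ)` are the case in which `ι` is moreover a closed embedding.) -/
structure IsMatrixLieGroup (ι : G →* GL (Fin m) ℝ) : Prop where
  injective : Function.Injective ι
  contMDiff : ContMDiff (𝓡 n) 𝓘(ℝ, Matrix (Fin m) (Fin m) ℝ) ∞ (toMat ι)
  immersion : ∀ g, Function.Injective
    (mfderiv (𝓡 n) 𝓘(ℝ, Matrix (Fin m) (Fin m) ℝ) (toMat ι) g)

/-- The differential of `ι` at the identity, from `T_e G` to the `m × m` matrices. -/
def tangentMap (ι : G →* GL (Fin m) ℝ) :
    TangentSpace (𝓡 n) (1 : G) →L[ℝ] Matrix (Fin m) (Fin m) ℝ :=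
  mfderiv (𝓡 n) 𝓘(ℝ, Matrix (Fin m) (Fin m) ℝ) (toMat ι) 1

/-- The Lie algebra `𝔤 = T_e G` as a subspace of `gl(m, ℝ)`. -/
def lieAlg (ι : G →* GL (Fin m) ℝ) : Submodule ℝ (Matrix (Fin m) (Fin m) ℝ) :=
  LinearMap.range (tangentMap (n := n) ι).toLinearMap

theorem hasMFDerivAt_toMat {ι : G →* GL (Fin m) ℝ} (hι : IsMatrixLieGroup (n := n) ι) :
    HasMFDerivAt (𝓡 n) 𝓘(ℝ, Matrix (Fin m) (Fin m) ℝ) (toMat ι) 1 (tangentMap (n := n) ι) :=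
  ((hι.contMDiff 1).mdifferentiableAt (by simp)).hasMFDerivAt

/-- `𝔤` is invariant under conjugation by group elements. -/
theorem conj_mem_lieAlg [LieGroup (𝓡 n) ∞ G] {ι : G →* GL (Fin m) ℝ}
    (hι : IsMatrixLieGroup (n := n) ι) (g : G) {B : Matrix (Fin m) (Fin m) ℝ}
    (hB : B ∈ lieAlg (n := n) ι) : toMat ι g * B * toMat ι g⁻¹ ∈ lieAlg (n := n) ι := by
  obtain ⟨b, rfl⟩ := hB
  have hc : ContMDiff (𝓡 n) (𝓡 n) ∞ (fun x : G => g * x * g⁻¹) :=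
    (contMDiff_const.mul contMDiff_id).mul contMDiff_const
  have hc1 : HasMFDerivAt (𝓡 n) (𝓡 n) (fun x : G => g * x * g⁻¹) 1
      (mfderiv (𝓡 n) (𝓡 n) (fun x : G => g * x * g⁻¹) 1) :=
    ((hc 1).mdifferentiableAt (by simp)).hasMFDerivAt
  have e1 : g * 1 * g⁻¹ = 1 := by simp
  have h1 : HasMFDerivAt (𝓡 n) 𝓘(ℝ, Matrix (Fin m) (Fin m) ℝ) (toMat ι) (g * 1 * g⁻¹)
      (tangentMap (n := n) ι) := by
    rw [e1]; exact hasMFDerivAt_toMat hι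
  have h2 := h1.comp (1 : G) hc1
  let L : Matrix (Fin m) (Fin m) ℝ →L[ℝ] Matrix (Fin m) (Fin m) ℝ :=
    (LinearMap.mulLeft ℝ (toMat ι g) ∘ₗ LinearMap.mulRight ℝ (toMat ι g⁻¹)).toContinuousLinearMap
  have hL : HasMFDerivAt 𝓘(ℝ, Matrix (Fin m) (Fin m) ℝ) 𝓘(ℝ, Matrix (Fin m) (Fin m) ℝ) L
      (toMat ι 1) L := L.hasMFDerivAt
  have h3 := hL.comp (1 : G) (hasMFDerivAt_toMat hι)
  have e2 : (toMat ι ∘ fun x : G => g * x * g⁻¹) = L ∘ toMat ι := by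
    funext x
    simp [L, toMat_mul, mul_assoc]
  rw [e2] at h2
  have h4 := hasMFDerivAt_unique h2 h3
  have h5 := congrArg (fun A => A b) h4
  refine ⟨mfderiv (𝓡 n) (𝓡 n) (fun x : G => g * x * g⁻¹) 1 b, ?_⟩
  refine Eq.trans h5 ?_
  change L (tangentMap (n := n) ι b) = _
  simp [L, mul_assoc]

/-- `𝔤` is closed under the commutator of matrices. -/
theorem commutator_mem_lieAlg [LieGroup (𝓡 n) ∞ G] {ι : G →* GL (Fin m) ℝ}
    (hι : IsMatrixLieGroup (n := n) ι) {A B : Matrix (Fin m) (Fin m) ℝ}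
    (hA : A ∈ lieAlg (n := n) ι) (hB : B ∈ lieAlg (n := n) ι) :
    A * B - B * A ∈ lieAlg (n := n) ι := by
  by_contra hAB
  obtain ⟨φ, hφ, hker⟩ := Submodule.exists_le_ker_of_notMem hAB
  apply hφ
  obtain ⟨a, rfl⟩ := hA
  have hJ := hasMFDerivAt_toMat hι
  have hW : HasMFDerivAt (𝓡 n) 𝓘(ℝ, Matrix (Fin m) (Fin m) ℝ) (fun x : G => toMat ι x⁻¹) 1
      (mfderiv (𝓡 n) 𝓘(ℝ, Matrix (Fin m) (Fin m) ℝ) (fun x : G => toMat ι x⁻¹) 1) := by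
    have hinv : ContMDiff (𝓡 n) (𝓡 n) ∞ (fun x : G => x⁻¹) := contMDiff_inv (𝓡 n) ∞
    exact (((hι.contMDiff.comp hinv) 1).mdifferentiableAt (by simp)).hasMFDerivAt
  set D : EuclideanSpace ℝ (Fin n) →L[ℝ] Matrix (Fin m) (Fin m) ℝ := tangentMap (n := n) ι with hD
  set D' : EuclideanSpace ℝ (Fin n) →L[ℝ] Matrix (Fin m) (Fin m) ℝ :=
    mfderiv (𝓡 n) 𝓘(ℝ, Matrix (Fin m) (Fin m) ℝ) (fun x : G => toMat ι x⁻¹) 1 with hD'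
  have hprod := hJ.mul' hW
  have hone : (toMat ι * fun x : G => toMat ι x⁻¹) = fun _ => 1 := by
    funext x; exact toMat_mul_inv ι x
  rw [hone] at hprod
  have h0 := congrArg (fun A => A a) (hasMFDerivAt_unique hprod (hasMFDerivAt_const _ _))
  have h0' : toMat ι 1 * D' a + D a * toMat ι (1 : G)⁻¹ = 0 := h0
  have hneg : D' a = -D a := by
    rw [inv_one, toMat_one, one_mul, mul_one] at h0'
    exact eq_neg_of_add_eq_zero_left h0'
  have hconst : HasMFDerivAt (𝓡 n) 𝓘(ℝ, Matrix (Fin m) (Fin m) ℝ) (fun _ : G => B) 1 0 :=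
    hasMFDerivAt_const _ _
  have hconj := (hJ.mul' hconst).mul' hW
  have hφ' : HasMFDerivAt 𝓘(ℝ, Matrix (Fin m) (Fin m) ℝ) 𝓘(ℝ, ℝ) φ.toContinuousLinearMap
      ((toMat ι * (fun _ : G => B) * fun x : G => toMat ι x⁻¹) 1) φ.toContinuousLinearMap :=
    ContinuousLinearMap.hasMFDerivAt _
  have hcomp := hφ'.comp (1 : G) hconj
  have hz : (φ.toContinuousLinearMap ∘
      (toMat ι * (fun _ : G => B) * fun x : G => toMat ι x⁻¹)) = fun _ => (0 : ℝ) := by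
    funext x
    exact hker (conj_mem_lieAlg hι x hB)
  rw [hz] at hcomp
  have h1 := congrArg (fun A => A a) (hasMFDerivAt_unique hcomp (hasMFDerivAt_const _ _))
  have h1' : φ ((toMat ι 1 * B) * D' a +
      (toMat ι 1 * 0 + D a * B) * toMat ι (1 : G)⁻¹) = 0 := h1
  rw [hneg, inv_one, toMat_one, one_mul, mul_zero, zero_add, mul_one] at h1'
  change φ (D a * B - B * D a) = 0
  rw [← h1']
  congr 1
  rw [mul_neg, sub_eq_neg_add]

/-- The identification of `T_e G` with the matrix Lie algebra. -/
def tangentEquiv {ι : G →* GL (Fin m) ℝ} (hι : IsMatrixLieGroup (n := n) ι) :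
    TangentSpace (𝓡 n) (1 : G) ≃ₗ[ℝ] lieAlg (n := n) ι :=
  LinearEquiv.ofInjective (tangentMap (n := n) ι).toLinearMap (hι.immersion 1)

/-- `Λ : ℝⁿ → 𝔤`, `x ↦ ∑ xⁱ Eᵢ`, for a basis `E` of `𝔤`. -/
def Lam {ι : G →* GL (Fin m) ℝ} (E : Module.Basis (Fin n) ℝ (lieAlg (n := n) ι)) :
    (Fin n → ℝ) ≃ₗ[ℝ] lieAlg (n := n) ι :=
  E.equivFun.symm

/-- The matrix commutator `ad_A B = A B - B A` on `𝔤`. -/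
def adMap [LieGroup (𝓡 n) ∞ G] {ι : G →* GL (Fin m) ℝ} (hι : IsMatrixLieGroup (n := n) ι)
    (A B : lieAlg (n := n) ι) : lieAlg (n := n) ι :=
  ⟨(A : Matrix (Fin m) (Fin m) ℝ) * B - B * A, commutator_mem_lieAlg hι A.2 B.2⟩

/-- The `n × n` matrix of `Λ⁻¹ ∘ ad_A ∘ Λ`; its `j`-th column is `Λ⁻¹ (ad_A (Λ e_j))`. -/
def adMatrix [LieGroup (𝓡 n) ∞ G] {ι : G →* GL (Fin m) ℝ} (hι : IsMatrixLieGroup (n := n) ι)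
    (E : Module.Basis (Fin n) ℝ (lieAlg (n := n) ι)) (A : lieAlg (n := n) ι) :
    Matrix (Fin n) (Fin n) ℝ :=
  Matrix.of fun i j => (Lam E).symm (adMap hι A (Lam E (Pi.single j 1))) i

/-- The left-trivialized differential of `V` at `g`, an element of `𝔤*`: the pullback of `dV(g)`
by the left translation `L_g`, that is, the differential at the identity of `x ↦ V (g x)`. -/
def leftDifferential {ι : G →* GL (Fin m) ℝ} (hι : IsMatrixLieGroup (n := n) ι)
    (V : G → ℝ) (g : G) : lieAlg (n := n) ι →ₗ[ℝ] ℝ :=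
  (mfderiv (𝓡 n) 𝓘(ℝ, ℝ) (fun x : G => V (g * x)) 1).toLinearMap ∘ₗ
    (tangentEquiv hι).symm.toLinearMap

/-- The left-trivialized gradient `d_g V ∈ ℝⁿ`: the components of the left-trivialized differential
with respect to the basis. -/
def leftGradient {ι : G →* GL (Fin m) ℝ} (hι : IsMatrixLieGroup (n := n) ι)
    (E : Module.Basis (Fin n) ℝ (lieAlg (n := n) ι)) (V : G → ℝ) (g : G) : Fin n → ℝ :=
  fun i => leftDifferential hι V g (Lam E (Pi.single i 1))

/-- `f` is tangent to `G`: `g⁻¹ f(g, t, θ)` lies in `𝔤`. -/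
def IsTangent (ι : G →* GL (Fin m) ℝ)
    (f : G → ℝ → EuclideanSpace ℝ (Fin p) → Matrix (Fin m) (Fin m) ℝ) : Prop :=
  ∀ g t θ, toMat ι g⁻¹ * f g t θ ∈ lieAlg (n := n) ι

/-- `f̃_θ(g, t) = g⁻¹ f_θ(g, t) ∈ 𝔤`. -/
def leftTriv {ι : G →* GL (Fin m) ℝ}
    {f : G → ℝ → EuclideanSpace ℝ (Fin p) → Matrix (Fin m) (Fin m) ℝ}
    (hf : IsTangent (n := n) ι f) (g : G) (t : ℝ) (θ : EuclideanSpace ℝ (Fin p)) :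
    lieAlg (n := n) ι :=
  ⟨toMat ι g⁻¹ * f g t θ, hf g t θ⟩

/-- The curve `γ` in `G` solves `γ' = f_θ(γ, t)`, `γ(0) = g₀` on `[0, T]`. -/
structure IsStateSolution (ι : G →* GL (Fin m) ℝ)
    (f : G → ℝ → EuclideanSpace ℝ (Fin p) → Matrix (Fin m) (Fin m) ℝ)
    (T : ℝ) (g₀ : G) (θ : EuclideanSpace ℝ (Fin p)) (γ : ℝ → G) : Prop where
  continuousOn : ContinuousOn γ (Icc 0 T)
  hasDeriv : ∀ t ∈ Icc 0 T,
    HasDerivWithinAt (fun s => toMat ι (γ s)) (f (γ t) t θ) (Icc 0 T) t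
  init : γ 0 = g₀

/-- The cost `C(g₀, θ) = F(Ψ^T(g₀), θ) + ∫₀ᵀ r(Ψ^s(g₀), θ, s) ds`, where `Ψ θ t` is the solution
operator at time `t` for the parameter `θ`. -/
def cost (Ψ : EuclideanSpace ℝ (Fin p) → ℝ → G → G) (F : G → EuclideanSpace ℝ (Fin p) → ℝ)
    (r : G → EuclideanSpace ℝ (Fin p) → ℝ → ℝ) (T : ℝ) (g₀ : G)
    (θ : EuclideanSpace ℝ (Fin p)) : ℝ :=
  F (Ψ θ T g₀) θ + ∫ s in (0 : ℝ)..T, r (Ψ θ s g₀) θ s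

/-- The state `γ` and the adjoint state `l` solve on `[0, T]` the state equation forward in time
and the adjoint equation
`l' = - d_g (lᵀ Λ⁻¹(f̃_θ) + r) + ad_{f̃_θ}ᵀ l`, `l(T) = d_g F`, backward in time.
In `d_g (lᵀ Λ⁻¹(f̃_θ) + r)` the adjoint state is held fixed. -/
structure IsAdjointSolution [LieGroup (𝓡 n) ∞ G] {ι : G →* GL (Fin m) ℝ}
    (hι : IsMatrixLieGroup (n := n) ι) (E : Module.Basis (Fin n) ℝ (lieAlg (n := n) ι))
    {f : G → ℝ → EuclideanSpace ℝ (Fin p) → Matrix (Fin m) (Fin m) ℝ}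
    (hf : IsTangent (n := n) ι f) (F : G → EuclideanSpace ℝ (Fin p) → ℝ)
    (r : G → EuclideanSpace ℝ (Fin p) → ℝ → ℝ) (T : ℝ) (g₀ : G)
    (θ : EuclideanSpace ℝ (Fin p)) (γ : ℝ → G) (l : ℝ → Fin n → ℝ) : Prop where
  state : IsStateSolution ι f T g₀ θ γ
  adjoint : ∀ t ∈ Icc 0 T, HasDerivWithinAt l
    (-leftGradient hι E (fun g => l t ⬝ᵥ (Lam E).symm (leftTriv hf g t θ) + r g θ t) (γ t)
      + (adMatrix hι E (leftTriv hf (γ t) t θ))ᵀ *ᵥ l t) (Icc 0 T) t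
  final : l T = leftGradient hι E (fun g => F g θ) (γ T)

/-- The integrand of the parameter gradient,
`∂/∂θ (lᵀ Λ⁻¹(f̃_θ)) + ∂r/∂θ`, along the state `γ` and the adjoint state `l`. -/
def gradientIntegrand {ι : G →* GL (Fin m) ℝ}
    (E : Module.Basis (Fin n) ℝ (lieAlg (n := n) ι))
    {f : G → ℝ → EuclideanSpace ℝ (Fin p) → Matrix (Fin m) (Fin m) ℝ}
    (hf : IsTangent (n := n) ι f) (r : G → EuclideanSpace ℝ (Fin p) → ℝ → ℝ)
    (θ : EuclideanSpace ℝ (Fin p)) (γ : ℝ → G) (l : ℝ → Fin n → ℝ) (t : ℝ) :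
    EuclideanSpace ℝ (Fin p) :=
  gradient (fun θ' => l t ⬝ᵥ (Lam E).symm (leftTriv hf (γ t) t θ')) θ
    + gradient (fun θ' => r (γ t) θ' t) θ

end LieAdjoint

end

/-! The flow is never differentiated in θ. Let γ be the solution for θ and h the one for a nearby
θ'. With ξ = g⁻¹f, the relative motion k = γ⁻¹h starts at the identity and satisfies k' = k ξ_θ'(h,
t) − ξ_θ(γ, t) k. Since h = γk, in coordinates y at the identity this is an ODE y' = Φ(γ(t), t; y,
θ') near 0 in ℝⁿ (`relField`). One parametrization σ at the identity therefore suffices, however far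
γ travels. Φ vanishes at (0, θ); its derivative there is that of Λ⁻¹ξ in (y, θ') minus ad_ξ acting
on y, the commutator coming from the multiplications on the two sides
(`IsLocalParam.fderiv_relField`). So the adjoint equation reads l' = −(∂_yΦ)ᵀ l − ∂_y r
(`IsLocalParam.adjoint_rhs`), a linear equation with continuous coefficients, whence existence and
uniqueness of l.

By this equation the terms linear in y cancel in (l · y)' plus the increment of r, and the terms
linear in θ' − θ are the claimed integrand. Integrating from y(0) = 0 and using that l(T) is the
y-derivative of F, the cost increment minus the claimed gradient applied to θ' − θ is a terminal
Taylor remainder plus the integral of l · (remainder of Φ) + (remainder of r)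
(`IsAdjointSolution.integral_duality`). These remainders are o(‖(y, θ' − θ)‖) uniformly over the
compact graph of γ (`IsCompact.eventually_norm_sub_fderiv_le`), and y = O(‖θ' − θ‖) by Grönwall
together with a continuation argument keeping k inside the chart
(`IsStateSolution.exists_norm_coordAtOne_le`). The same estimate at θ' = θ gives uniqueness of the
state. -/

noncomputable section

open Filter Topology

/-! ### First-order expansions uniform over a compact set of parameters -/

section Manifold

variable {E₀ : Type*} [NormedAddCommGroup E₀] [NormedSpace ℝ E₀] {H : Type*} [TopologicalSpace H]
  {I : ModelWithCorners ℝ E₀ H} {N : Type*} [TopologicalSpace N] [ChartedSpace H N]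
  {E : Type*} [NormedAddCommGroup E] [NormedSpace ℝ E]
  {W : Type*} [NormedAddCommGroup W] [NormedSpace ℝ W]

/-- The partial derivative in the vector variable of a `C¹` function of a point of a manifold and
a vector is jointly continuous. -/
theorem ContMDiffAt.continuousAt_fderiv_snd [IsManifold I 1 N] {Φ : N → E → W} {z : N} {u : E}
    (h : ContMDiffAt (I.prod 𝓘(ℝ, E)) 𝓘(ℝ, W) 1 (Function.uncurry Φ) (z, u)) :
    ContinuousAt (fun q : N × E => fderiv ℝ (Φ q.1) q.2) (z, u) := by
  -- `ContMDiffAt.mfderiv` differentiates in v at a point depending on a parameter; the parameter is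
  -- the pair (z, u) itself and the point is its second component.
  have h1 : ContMDiffAt ((I.prod 𝓘(ℝ, E)).prod 𝓘(ℝ, E)) 𝓘(ℝ, W) 1
      (Function.uncurry fun (q : N × E) (v : E) => Φ q.1 v) ((z, u), u) := by
    have h2 : ContMDiffAt ((I.prod 𝓘(ℝ, E)).prod 𝓘(ℝ, E)) (I.prod 𝓘(ℝ, E)) 1
        (fun x : (N × E) × E => (x.1.1, x.2)) ((z, u), u) :=
      (contMDiffAt_fst.comp _ contMDiffAt_fst).prodMk contMDiffAt_snd
    exact ContMDiffAt.comp (g := Function.uncurry Φ) ((z, u), u) h h2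
  have h3 := (ContMDiffAt.mfderiv (m := 0) (fun (q : N × E) (v : E) => Φ q.1 v)
    (fun q : N × E => q.2) h1 contMDiffAt_snd (by simp)).continuousAt
  have h4 := inTangentCoordinates_model_space (I := 𝓘(ℝ, E)) (I' := 𝓘(ℝ, W))
    (fun q : N × E => q.2) (fun q : N × E => Φ q.1 q.2)
    (fun q : N × E => fderiv ℝ (Φ q.1) q.2) (z, u)
  rw [← h4]
  simpa only [mfderiv_eq_fderiv] using h3

theorem ContMDiffAt.eventually_differentiableAt_snd [IsManifold I 1 N] {Φ : N → E → W} {z : N}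
    {u : E} (h : ContMDiffAt (I.prod 𝓘(ℝ, E)) 𝓘(ℝ, W) 1 (Function.uncurry Φ) (z, u)) :
    ∀ᶠ q : N × E in 𝓝 (z, u), DifferentiableAt ℝ (Φ q.1) q.2 := by
  filter_upwards [contMDiffAt_iff_contMDiffAt_nhds (by simp) |>.1 h] with q hq
  have h2 : ContMDiffAt 𝓘(ℝ, E) (I.prod 𝓘(ℝ, E)) 1 (fun v : E => (q.1, v)) q.2 :=
    contMDiffAt_const.prodMk contMDiffAt_id
  have h3 : ContMDiffAt 𝓘(ℝ, E) 𝓘(ℝ, W) 1 (Φ q.1) q.2 :=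
    ContMDiffAt.comp (g := Function.uncurry Φ) q.2 hq h2
  exact (contMDiffAt_iff_contDiffAt.1 h3).differentiableAt (by simp)

/-- A first-order expansion in the vector variable, uniform over a compact set of parameters. -/
theorem IsCompact.eventually_norm_sub_fderiv_le [IsManifold I 1 N] {Φ : N → E → W} {K : Set N}
    (hK : IsCompact K) {u₀ : E}
    (h : ∀ z ∈ K, ContMDiffAt (I.prod 𝓘(ℝ, E)) 𝓘(ℝ, W) 1 (Function.uncurry Φ) (z, u₀))
    {ε : ℝ} (hε : 0 < ε) :
    ∀ᶠ u in 𝓝 u₀, ∀ z ∈ K,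
      ‖Φ z u - Φ z u₀ - fderiv ℝ (Φ z) u₀ (u - u₀)‖ ≤ ε * ‖u - u₀‖ := by
  refine hK.eventually_forall_of_forall_eventually fun z hz => ?_
  have hc := (h z hz).continuousAt_fderiv_snd
  have h1 : ∀ᶠ q : N × E in 𝓝 (z, u₀), DifferentiableAt ℝ (Φ q.1) q.2 ∧
      ‖fderiv ℝ (Φ q.1) q.2 - fderiv ℝ (Φ z) u₀‖ < ε / 2 := by
    refine (h z hz).eventually_differentiableAt_snd.and ?_
    have := Metric.tendsto_nhds.1 hc (ε / 2) (by positivity)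
    simpa only [dist_eq_norm] using this
  rw [nhds_prod_eq] at h1 ⊢
  obtain ⟨p₁, hp₁, p₂, hp₂, hp⟩ := eventually_prod_iff.1 h1
  obtain ⟨ρ, hρ, hb⟩ := Metric.eventually_nhds_iff_ball.1 hp₂
  refine eventually_prod_iff.2 ⟨_, Metric.ball_mem_nhds u₀ hρ, p₁, hp₁, ?_⟩
  intro u hu z' hz'
  have hmem : u₀ ∈ Metric.ball u₀ ρ := Metric.mem_ball_self hρ
  -- Mean value inequality for the map minus its linear part at u₀: both derivatives lie within ε/2
  -- of the one at (z, u₀).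
  refine (convex_ball u₀ ρ).norm_image_sub_le_of_norm_fderiv_le' (𝕜 := ℝ)
    (fun x hx => (hp hz' (hb x hx)).1) (fun x hx => ?_) hmem hu
  have e1 := (hp hz' (hb x hx)).2
  have e2 := (hp hz' (hb u₀ hmem)).2
  calc ‖fderiv ℝ (Φ z') x - fderiv ℝ (Φ z') u₀‖
      = ‖(fderiv ℝ (Φ z') x - fderiv ℝ (Φ z) u₀) - (fderiv ℝ (Φ z') u₀ - fderiv ℝ (Φ z) u₀)‖ := by
        rw [sub_sub_sub_cancel_right]
    _ ≤ _ := norm_sub_le _ _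
    _ ≤ ε := by linarith

end Manifold

/-! ### Global solvability and uniqueness for linear equations -/

section LinearODE

variable {n : ℕ}

/-- Coordinatewise truncation of a vector to the cube `[-R, R]ⁿ`. -/
def clampVec (R : ℝ) (x : Fin n → ℝ) : Fin n → ℝ := fun i => max (-R) (min R (x i))

theorem norm_clampVec_sub_le (R : ℝ) (x y : Fin n → ℝ) :
    ‖clampVec R x - clampVec R y‖ ≤ ‖x - y‖ := by
  refine (pi_norm_le_iff_of_nonneg (norm_nonneg _)).2 fun i => ?_
  refine le_trans ?_ (norm_le_pi_norm (x - y) i)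
  simp only [Pi.sub_apply, clampVec, Real.norm_eq_abs]
  calc |max (-R) (min R (x i)) - max (-R) (min R (y i))|
      ≤ |min R (x i) - min R (y i)| := by
        simpa using abs_max_sub_max_le_max (-R) (min R (x i)) (-R) (min R (y i))
    _ ≤ |x i - y i| := by
        simpa using abs_min_sub_min_le_max R (x i) R (y i)

theorem clampVec_of_norm_le {R : ℝ} {x : Fin n → ℝ} (hx : ‖x‖ ≤ R) : clampVec R x = x := by
  funext i
  have := abs_le.1 ((norm_le_pi_norm x i).trans hx)
  simp [clampVec, this.1, this.2]

theorem norm_clampVec_le_norm {R : ℝ} (hR : 0 ≤ R) (x : Fin n → ℝ) : ‖clampVec R x‖ ≤ ‖x‖ := by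
  have := norm_clampVec_sub_le R x 0
  rwa [clampVec_of_norm_le (x := (0 : Fin n → ℝ)) (by simpa), sub_zero, sub_zero] at this

theorem norm_clampVec_le {R : ℝ} (hR : 0 ≤ R) (x : Fin n → ℝ) : ‖clampVec R x‖ ≤ R := by
  refine (pi_norm_le_iff_of_nonneg hR).2 fun i => ?_
  simp only [clampVec, Real.norm_eq_abs, abs_le]
  exact ⟨le_max_left _ _, max_le (by linarith) (min_le_left _ _)⟩

/-- Grönwall's inequality asks for right derivatives, in contrast to the two-sided form used for
solutions on a closed interval. -/
theorem HasDerivWithinAt.Icc_to_Ici {E : Type*} [NormedAddCommGroup E] [NormedSpace ℝ E]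
    {φ : ℝ → E} {φ' : E} {a b t : ℝ} (h : HasDerivWithinAt φ φ' (Icc a b) t) (ht : t ∈ Ico a b) :
    HasDerivWithinAt φ φ' (Ici t) t :=
  h.mono_of_mem_nhdsWithin (mem_of_superset (Icc_mem_nhdsGE ht.2) (Icc_subset_Icc_left ht.1))

theorem HasDerivWithinAt.Icc_to_Iic {E : Type*} [NormedAddCommGroup E] [NormedSpace ℝ E]
    {φ : ℝ → E} {φ' : E} {a b t : ℝ} (h : HasDerivWithinAt φ φ' (Icc a b) t) (ht : t ∈ Ioc a b) :
    HasDerivWithinAt φ φ' (Iic t) t :=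
  h.mono_of_mem_nhdsWithin (mem_of_superset (Icc_mem_nhdsLE ht.1) (Icc_subset_Icc_right ht.2))

/-- A linear initial value problem with continuous coefficients has a solution on the whole
interval. -/
theorem exists_solution_linear_ODE {T : ℝ} (hT : 0 ≤ T)
    {A : ℝ → (Fin n → ℝ) →L[ℝ] (Fin n → ℝ)} {b : ℝ → Fin n → ℝ}
    (hA : ContinuousOn A (Icc 0 T)) (hb : ContinuousOn b (Icc 0 T)) (x₀ : Fin n → ℝ) :
    ∃ l : ℝ → Fin n → ℝ, l 0 = x₀ ∧
      ∀ t ∈ Icc 0 T, HasDerivWithinAt l (A t (l t) + b t) (Icc 0 T) t := by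
  obtain ⟨a, ha⟩ := isCompact_Icc.exists_bound_of_continuousOn hA
  obtain ⟨c, hc⟩ := isCompact_Icc.exists_bound_of_continuousOn hb
  have h0 : (0 : ℝ) ∈ Icc 0 T := ⟨le_rfl, hT⟩
  have ha0 : 0 ≤ a := (norm_nonneg _).trans (ha 0 h0)
  have hc0 : 0 ≤ c := (norm_nonneg _).trans (hc 0 h0)
  -- R is an a priori bound for every solution, so truncating the field at radius R will turn out to
  -- change nothing.
  set R := gronwallBound ‖x₀‖ a c T with hR
  have hRmono := gronwallBound_mono (norm_nonneg x₀) hc0 ha0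
  have hR0 : 0 ≤ R := by
    have := hRmono hT
    rw [gronwallBound_x0] at this
    exact (norm_nonneg _).trans this
  -- The truncated field is bounded by aR + c everywhere, so the ball of radius (aR + c)T cannot be
  -- left in time T and Picard–Lindelöf covers the whole interval.
  have hPL : IsPicardLindelof (fun t x => A t (clampVec R x) + b t) (⟨0, h0⟩ : Icc (0 : ℝ) T) x₀
      (⟨(a * R + c) * T, by positivity⟩) 0 ⟨a * R + c, by positivity⟩ ⟨a, ha0⟩ := by
    constructor
    · intro t ht x _ y _
      have : ‖(A t (clampVec R x) + b t) - (A t (clampVec R y) + b t)‖ ≤ a * ‖x - y‖ := by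
        rw [add_sub_add_right_eq_sub, ← map_sub]
        exact (A t).le_of_opNorm_le_of_le (ha t ht) (norm_clampVec_sub_le R x y)
      rw [edist_dist, edist_dist, dist_eq_norm, dist_eq_norm,
        ENNReal.ofReal_le_iff_le_toReal (by finiteness)]
      simpa [NNReal.coe_mk] using! this
    · intro x _
      exact (hA.clm_apply continuousOn_const).add hb
    · intro t ht x _
      refine (norm_add_le _ _).trans (add_le_add ?_ (hc t ht))
      exact (A t).le_of_opNorm_le_of_le (ha t ht) (norm_clampVec_le hR0 x)
    · rw [sub_zero, sub_zero, max_eq_left hT, NNReal.coe_zero, sub_zero]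
      exact le_rfl
  obtain ⟨l, hl0, hl⟩ := hPL.exists_eq_forall_mem_Icc_hasDerivWithinAt₀
  refine ⟨l, hl0, fun t ht => ?_⟩
  -- Truncation does not increase norms, so the solution obeys the same growth inequality; it stays
  -- within R, where the truncation is the identity.
  have hbound : ‖l t‖ ≤ R := by
    refine (norm_le_gronwallBound_of_norm_deriv_right_le (K := a) (ε := c) (δ := ‖x₀‖)
      (fun s hs => (hl s hs).continuousWithinAt)
      (fun s hs => (hl s (Ico_subset_Icc_self hs)).Icc_to_Ici hs) (by
        change l 0 = x₀ at hl0
        rw [hl0]) (fun s hs => ?_) t ht).trans ?_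
    · have hs' := Ico_subset_Icc_self hs
      refine (norm_add_le _ _).trans (add_le_add ?_ (hc s hs'))
      exact (A s).le_of_opNorm_le_of_le (ha s hs') (norm_clampVec_le_norm hR0 _)
    · rw [sub_zero]; exact hRmono ht.2
  simpa only [clampVec_of_norm_le hbound] using hl t ht

/-- A linear terminal value problem with continuous coefficients has a solution on the whole
interval. -/
theorem exists_solution_linear_ODE_backward {T : ℝ} (hT : 0 ≤ T)
    {A : ℝ → (Fin n → ℝ) →L[ℝ] (Fin n → ℝ)} {b : ℝ → Fin n → ℝ}
    (hA : ContinuousOn A (Icc 0 T)) (hb : ContinuousOn b (Icc 0 T)) (x₀ : Fin n → ℝ) :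
    ∃ l : ℝ → Fin n → ℝ, l T = x₀ ∧
      ∀ t ∈ Icc 0 T, HasDerivWithinAt l (A t (l t) + b t) (Icc 0 T) t := by
  have hm : MapsTo (fun t => T - t) (Icc 0 T) (Icc 0 T) := fun t ht =>
    ⟨by linarith [ht.2], by linarith [ht.1]⟩
  have hcs : ContinuousOn (fun t => T - t) (Icc 0 T) := by fun_prop
  -- Time reversal t ↦ T − t turns the terminal condition into an initial one.
  obtain ⟨l, hl0, hl⟩ := exists_solution_linear_ODE hT (A := fun t => -A (T - t))
    (b := fun t => -b (T - t)) (hA.comp hcs hm).neg (hb.comp hcs hm).neg x₀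
  refine ⟨fun t => l (T - t), by simpa using hl0, fun t ht => ?_⟩
  have h1 : HasDerivWithinAt (fun t => T - t) (-1) (Icc 0 T) t := by
    simpa using (hasDerivWithinAt_id t (Icc 0 T)).const_sub T
  have h2 := (hl (T - t) (hm ht)).scomp t h1 hm
  refine h2.congr_deriv ?_
  simp [add_comm]

/-- The right-hand side is Lipschitz with the supremum of ‖A‖ as constant, so the terminal value
determines the solution. -/
theorem eqOn_of_linear_ODE_backward {T : ℝ}
    {A : ℝ → (Fin n → ℝ) →L[ℝ] (Fin n → ℝ)} {b : ℝ → Fin n → ℝ}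
    (hA : ContinuousOn A (Icc 0 T)) {l₁ l₂ : ℝ → Fin n → ℝ}
    (h₁ : ∀ t ∈ Icc 0 T, HasDerivWithinAt l₁ (A t (l₁ t) + b t) (Icc 0 T) t)
    (h₂ : ∀ t ∈ Icc 0 T, HasDerivWithinAt l₂ (A t (l₂ t) + b t) (Icc 0 T) t)
    (hTT : l₁ T = l₂ T) : EqOn l₁ l₂ (Icc 0 T) := by
  obtain ⟨a, ha⟩ := isCompact_Icc.exists_bound_of_continuousOn hA
  refine ODE_solution_unique_of_mem_Icc_left (v := fun t x => A t x + b t) (s := fun _ => univ)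
    (K := a.toNNReal) (fun t ht => ?_) (fun s hs => (h₁ s hs).continuousWithinAt)
    (fun t ht => (h₁ t (Ioc_subset_Icc_self ht)).Icc_to_Iic ht) (fun _ _ => mem_univ _)
    (fun s hs => (h₂ s hs).continuousWithinAt)
    (fun t ht => (h₂ t (Ioc_subset_Icc_self ht)).Icc_to_Iic ht) (fun _ _ => mem_univ _) hTT
  refine LipschitzOnWith.of_dist_le_mul fun x _ y _ => ?_
  rw [dist_eq_norm, dist_eq_norm, add_sub_add_right_eq_sub, ← map_sub]
  exact (A t).le_of_opNorm_le ((ha t (Ioc_subset_Icc_self ht)).trans (Real.le_coe_toNNReal a)) _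

end LinearODE

/-- Continuous induction: a curve which starts in the closed set `C` and which, as long as it has
stayed in `C`, lies in the interior of `C`, never leaves `C`. -/
theorem forall_mem_of_bootstrap {X : Type*} [TopologicalSpace X] {T : ℝ} {k : ℝ → X} {C : Set X}
    (hk : ContinuousOn k (Icc 0 T)) (hC : IsClosed C) (h0 : k 0 ∈ C)
    (h : ∀ t ∈ Icc 0 T, (∀ s ∈ Icc 0 t, k s ∈ C) → k t ∈ interior C) :
    ∀ t ∈ Icc 0 T, k t ∈ C := by
  have hcl : IsClosed ({t | ∀ s ∈ Icc 0 t, k s ∈ C} ∩ Icc 0 T) := by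
    rw [← isSeqClosed_iff_isClosed]
    intro x t hx hxt
    have ht : t ∈ Icc 0 T := isClosed_Icc.mem_of_tendsto hxt (Eventually.of_forall fun i => (hx i).2)
    refine ⟨fun s hs => ?_, ht⟩
    rcases eq_or_lt_of_le hs.2 with rfl | hlt
    · have h1 : Tendsto x atTop (𝓝[Icc 0 T] s) :=
        tendsto_nhdsWithin_iff.2 ⟨hxt, Eventually.of_forall fun i => (hx i).2⟩
      exact hC.mem_of_tendsto ((hk s ht).tendsto.comp h1)
        (Eventually.of_forall fun i => (hx i).1 _ ⟨(hx i).2.1, le_rfl⟩)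
    · obtain ⟨i, hi⟩ := (hxt.eventually (lt_mem_nhds hlt)).exists
      exact (hx i).1 s ⟨hs.1, hi.le⟩
  have key : Icc 0 T ⊆ {t | ∀ s ∈ Icc 0 t, k s ∈ C} := by
    refine hcl.Icc_subset_of_forall_exists_gt (fun s hs => ?_) fun t ht y hy => ?_
    · rwa [le_antisymm hs.2 hs.1]
    · have htI : t ∈ Icc 0 T := Ico_subset_Icc_self ht.2
      have hint := (hk t htI) (isOpen_interior.mem_nhds (h t htI ht.1))
      -- Having stayed in C up to t, the curve is in the interior at t, hence in C slightly beyond: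
      -- the open step of the induction.
      have hnear : k ⁻¹' interior C ∈ 𝓝[≥] t :=
        (nhdsWithin_le_of_mem (mem_of_superset (Icc_mem_nhdsGE ht.2.2)
          (Icc_subset_Icc_left ht.2.1))) hint
      obtain ⟨u, hu, hsub⟩ := (mem_nhdsGE_iff_exists_Icc_subset).1 hnear
      refine ⟨min u y, fun s hs => ?_, lt_min hu hy, min_le_right _ _⟩
      rcases le_total s t with hst | hst
      · exact ht.1 s ⟨hs.1, hst⟩
      · exact interior_subset (hsub ⟨hst, hs.2.trans (min_le_left _ _)⟩)
  exact fun t ht => key ht t ⟨ht.1, le_rfl⟩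

/-! ### Coordinates and a local parametrization at the identity -/

namespace LieAdjoint

variable {n m p : ℕ} {G : Type*} [TopologicalSpace G]
  [ChartedSpace (EuclideanSpace ℝ (Fin n)) G] [Group G]

/-- A linear extension of `Λ⁻¹ : 𝔤 → ℝⁿ` to all matrices. -/
def coordProj {ι : G →* GL (Fin m) ℝ} (E : Module.Basis (Fin n) ℝ (lieAlg (n := n) ι)) :
    Matrix (Fin m) (Fin m) ℝ →L[ℝ] (Fin n → ℝ) :=
  (LinearMap.exists_extend (Lam E).symm.toLinearMap).choose.toContinuousLinearMap

theorem coordProj_coe {ι : G →* GL (Fin m) ℝ} (E : Module.Basis (Fin n) ℝ (lieAlg (n := n) ι))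
    (A : lieAlg (n := n) ι) : coordProj E A = (Lam E).symm A :=
  LinearMap.congr_fun (LinearMap.exists_extend (Lam E).symm.toLinearMap).choose_spec A

/-- The map `Λ`, with values in the space of all matrices. -/
def matLam {ι : G →* GL (Fin m) ℝ} (E : Module.Basis (Fin n) ℝ (lieAlg (n := n) ι)) :
    (Fin n → ℝ) →L[ℝ] Matrix (Fin m) (Fin m) ℝ :=
  ((lieAlg (n := n) ι).subtype ∘ₗ (Lam E).toLinearMap).toContinuousLinearMap

theorem matLam_apply {ι : G →* GL (Fin m) ℝ} (E : Module.Basis (Fin n) ℝ (lieAlg (n := n) ι))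
    (x : Fin n → ℝ) : matLam E x = (Lam E x : Matrix (Fin m) (Fin m) ℝ) := rfl

theorem coordProj_matLam {ι : G →* GL (Fin m) ℝ}
    (E : Module.Basis (Fin n) ℝ (lieAlg (n := n) ι)) (x : Fin n → ℝ) :
    coordProj E (matLam E x) = x := by
  rw [matLam_apply, coordProj_coe, LinearEquiv.symm_apply_apply]

theorem matLam_coordProj {ι : G →* GL (Fin m) ℝ}
    (E : Module.Basis (Fin n) ℝ (lieAlg (n := n) ι)) {A : Matrix (Fin m) (Fin m) ℝ}
    (hA : A ∈ lieAlg (n := n) ι) : matLam E (coordProj E A) = A := by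
  have := coordProj_coe E ⟨A, hA⟩
  rw [matLam_apply, this, LinearEquiv.apply_symm_apply]

/-- Globally defined functions on `G` which are coordinates near the identity. -/
def coordAtOne {ι : G →* GL (Fin m) ℝ} (E : Module.Basis (Fin n) ℝ (lieAlg (n := n) ι)) (k : G) :
    Fin n → ℝ := coordProj E (toMat ι k - 1)

theorem coordAtOne_one {ι : G →* GL (Fin m) ℝ}
    (E : Module.Basis (Fin n) ℝ (lieAlg (n := n) ι)) : coordAtOne E (1 : G) = 0 := by
  simp [coordAtOne, toMat_one]

theorem contMDiff_coordAtOne {ι : G →* GL (Fin m) ℝ} (hι : IsMatrixLieGroup (n := n) ι)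
    (E : Module.Basis (Fin n) ℝ (lieAlg (n := n) ι)) :
    ContMDiff (𝓡 n) 𝓘(ℝ, Fin n → ℝ) ∞ (coordAtOne E : G → Fin n → ℝ) := by
  have h : ContDiff ℝ ∞ (fun A : Matrix (Fin m) (Fin m) ℝ => coordProj E (A - 1)) := by fun_prop
  exact h.contMDiff.comp hι.contMDiff

theorem hasMFDerivAt_coordAtOne {ι : G →* GL (Fin m) ℝ} (hι : IsMatrixLieGroup (n := n) ι)
    (E : Module.Basis (Fin n) ℝ (lieAlg (n := n) ι)) :
    HasMFDerivAt (𝓡 n) 𝓘(ℝ, Fin n → ℝ) (coordAtOne E) (1 : G)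
      ((coordProj E).comp (tangentMap (n := n) ι)) := by
  have h : HasFDerivAt (fun A : Matrix (Fin m) (Fin m) ℝ => coordProj E (A - 1)) (coordProj E)
      (toMat ι 1) := (coordProj E).hasFDerivAt.comp _ ((hasFDerivAt_id _).sub_const 1)
  exact h.hasMFDerivAt.comp (1 : G) (hasMFDerivAt_toMat hι)

theorem tangentMap_mem_lieAlg {ι : G →* GL (Fin m) ℝ} (v : TangentSpace (𝓡 n) (1 : G)) :
    tangentMap (n := n) ι v ∈ lieAlg (n := n) ι := LinearMap.mem_range_self _ _

/-- The immersion is injective on tangent vectors, and on its image 𝔤 the projection is undone by Λ.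
-/
theorem coordProj_comp_tangentMap_injective {ι : G →* GL (Fin m) ℝ}
    (hι : IsMatrixLieGroup (n := n) ι) (E : Module.Basis (Fin n) ℝ (lieAlg (n := n) ι)) :
    Function.Injective ((coordProj E).comp (tangentMap (n := n) ι)) := by
  intro v w hvw
  have h := congrArg (matLam E) hvw
  simp only [ContinuousLinearMap.comp_apply] at h
  rw [matLam_coordProj E (tangentMap_mem_lieAlg v),
    matLam_coordProj E (tangentMap_mem_lieAlg w)] at h
  exact hι.immersion 1 h

/-- `σ` is a local parametrization of `G` near the identity, inverse to the coordinates
`coordAtOne`. -/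
structure IsLocalParam {ι : G →* GL (Fin m) ℝ} (E : Module.Basis (Fin n) ℝ (lieAlg (n := n) ι))
    (σ : (Fin n → ℝ) → G) : Prop where
  zero : σ 0 = 1
  contMDiffAt : ContMDiffAt 𝓘(ℝ, Fin n → ℝ) (𝓡 n) 1 σ 0
  right_inv : ∀ᶠ x in 𝓝 0, coordAtOne E (σ x) = x
  left_inv : ∀ᶠ k in 𝓝 1, σ (coordAtOne E k) = k

/-- Inverse function theorem in a chart at the identity: the differential of the coordinates is
injective, hence bijective because both sides have dimension n. Away from 0 the values of σ are
irrelevant. -/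
theorem exists_isLocalParam [IsManifold (𝓡 n) ∞ G] {ι : G →* GL (Fin m) ℝ}
    (hι : IsMatrixLieGroup (n := n) ι) (E : Module.Basis (Fin n) ℝ (lieAlg (n := n) ι)) :
    ∃ σ : (Fin n → ℝ) → G, IsLocalParam E σ := by
  have hd := (hasMFDerivAt_coordAtOne hι E).2
  have hs := (contMDiffAt_iff.1 (contMDiff_coordAtOne hι E 1)).2
  set φ := extChartAt (𝓡 n) (1 : G) with hφ
  set e := φ 1 with he
  set ψ : EuclideanSpace ℝ (Fin n) → Fin n → ℝ := coordAtOne E ∘ φ.symm with hψ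
  let D : EuclideanSpace ℝ (Fin n) →L[ℝ] (Fin n → ℝ) :=
    (coordProj E).comp (tangentMap (n := n) ι)
  have hd' : HasFDerivAt ψ D e := by
    have hd2 : HasFDerivWithinAt ψ D (range (𝓡 n)) e := hd
    rwa [ModelWithCorners.range_eq_univ, hasFDerivWithinAt_univ] at hd2
  have hs' : ContDiffAt ℝ ∞ ψ e := by
    rw [ModelWithCorners.range_eq_univ, contDiffWithinAt_univ] at hs
    exact hs
  let L : EuclideanSpace ℝ (Fin n) ≃L[ℝ] (Fin n → ℝ) :=
    (LinearMap.linearEquivOfInjective D.toLinearMap (coordProj_comp_tangentMap_injective hι E) (by simp)).toContinuousLinearEquiv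
  have hL : HasFDerivAt ψ (L : EuclideanSpace ℝ (Fin n) →L[ℝ] Fin n → ℝ) e := by
    refine hd'.congr_fderiv ?_
    ext1 x
    rfl
  have hstrict := hs'.hasStrictFDerivAt' hL (by simp)
  have he1 : φ.symm e = 1 := extChartAt_to_inv (I := 𝓡 n) (1 : G)
  have hψe : ψ e = 0 := by
    simp only [hψ, Function.comp_apply, he1, coordAtOne_one]
  have hinvC : ContDiffAt ℝ ∞ (hstrict.localInverse ψ L e) 0 := by
    have := hs'.to_localInverse hL (by simp)
    rwa [hψe] at this
  have hle : hstrict.localInverse ψ L e 0 = e := by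
    rw [← hψe]; exact hstrict.localInverse_apply_image
  have hsymm : ContMDiffAt 𝓘(ℝ, EuclideanSpace ℝ (Fin n)) (𝓡 n) ∞ φ.symm e :=
    (contMDiffOn_extChartAt_symm (1 : G)).contMDiffAt (extChartAt_target_mem_nhds (1 : G))
  refine ⟨φ.symm ∘ hstrict.localInverse ψ L e, ?_, ?_, ?_, ?_⟩
  · rw [Function.comp_apply, hle, he1]
  · refine (ContMDiffAt.comp (0 : Fin n → ℝ) ?_ hinvC.contMDiffAt).of_le (by simp)
    rw [hle]; exact hsymm
  · have := hstrict.eventually_right_inverse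
    rwa [hψe] at this
  · have h1 : Tendsto φ (𝓝 (1 : G)) (𝓝 e) := continuousAt_extChartAt (1 : G)
    filter_upwards [h1.eventually hstrict.eventually_left_inverse,
      extChartAt_source_mem_nhds (I := 𝓡 n) (1 : G)] with k hk hks
    have hk2 : φ.symm (φ k) = k := φ.left_inv hks
    have hk3 : ψ (φ k) = coordAtOne E k := congrArg (coordAtOne E) hk2
    rw [hk3] at hk
    rw [Function.comp_apply, hk, hk2]

section Derivatives

variable {ι : G →* GL (Fin m) ℝ} {E : Module.Basis (Fin n) ℝ (lieAlg (n := n) ι)}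
  {σ : (Fin n → ℝ) → G}

variable (σ) in
/-- The differential at the origin of a parametrization of `G`. -/
def paramDeriv : (Fin n → ℝ) →L[ℝ] EuclideanSpace ℝ (Fin n) :=
  mfderiv 𝓘(ℝ, Fin n → ℝ) (𝓡 n) σ 0

theorem IsLocalParam.hasMFDerivAt (hσ : IsLocalParam E σ) :
    HasMFDerivAt 𝓘(ℝ, Fin n → ℝ) (𝓡 n) σ 0 (paramDeriv σ) :=
  (hσ.contMDiffAt.mdifferentiableAt (by simp)).hasMFDerivAt

/-- The differential at the identity of the parametrization is `Λ`. -/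
theorem IsLocalParam.tangentMap_paramDeriv (hσ : IsLocalParam E σ)
    (hι : IsMatrixLieGroup (n := n) ι) (x : Fin n → ℝ) :
    tangentMap (n := n) ι (paramDeriv σ x : EuclideanSpace ℝ (Fin n)) = matLam E x := by
  have h1 : HasMFDerivAt (𝓡 n) 𝓘(ℝ, Fin n → ℝ) (coordAtOne E) (σ 0)
      ((coordProj E).comp (tangentMap (n := n) ι)) := by
    rw [hσ.zero]; exact hasMFDerivAt_coordAtOne hι E
  have h2 := h1.comp (0 : Fin n → ℝ) hσ.hasMFDerivAt
  -- Near 0 the coordinates of σ(x) are x, so the chain rule gives P ∘ dι ∘ dσ = id with P =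
  -- `coordProj E`; as dι takes values in 𝔤, P can be inverted by Λ.
  have h3 : HasMFDerivAt 𝓘(ℝ, Fin n → ℝ) 𝓘(ℝ, Fin n → ℝ) (coordAtOne E ∘ σ) 0
      (ContinuousLinearMap.id ℝ (Fin n → ℝ)) :=
    ((hasFDerivAt_id (0 : Fin n → ℝ)).congr_of_eventuallyEq hσ.right_inv).hasMFDerivAt
  have h4 := congrArg (fun A => A x) (hasMFDerivAt_unique h2 h3)
  have h5 : coordProj E (tangentMap (n := n) ι (paramDeriv σ x : EuclideanSpace ℝ (Fin n))) = x :=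
    h4
  refine (matLam_coordProj E (tangentMap_mem_lieAlg (ι := ι) _)).symm.trans ?_
  exact congrArg (matLam E) h5

theorem IsLocalParam.hasFDerivAt_toMat (hσ : IsLocalParam E σ)
    (hι : IsMatrixLieGroup (n := n) ι) :
    HasFDerivAt (fun x => toMat ι (σ x)) (matLam E) 0 := by
  have h1 : HasMFDerivAt (𝓡 n) 𝓘(ℝ, Matrix (Fin m) (Fin m) ℝ) (toMat ι) (σ 0)
      (tangentMap (n := n) ι) := by
    rw [hσ.zero]; exact hasMFDerivAt_toMat hι
  have h2 := (h1.comp (0 : Fin n → ℝ) hσ.hasMFDerivAt).hasFDerivAt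
  refine HasFDerivAt.congr_fderiv (f' := ((tangentMap (n := n) ι :
    EuclideanSpace ℝ (Fin n) →L[ℝ] _).comp (paramDeriv σ))) h2 ?_
  ext1 x
  exact hσ.tangentMap_paramDeriv hι x

/-- The left-trivialized gradient is the ordinary gradient in the local parametrization. -/
theorem IsLocalParam.leftGradient_eq (hσ : IsLocalParam E σ) (hι : IsMatrixLieGroup (n := n) ι)
    [LieGroup (𝓡 n) ∞ G] {V : G → ℝ} {g : G} (hV : MDifferentiableAt (𝓡 n) 𝓘(ℝ, ℝ) V g)
    (i : Fin n) :
    leftGradient hι E V g i = fderiv ℝ (fun x => V (g * σ x)) 0 (Pi.single i 1) := by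
  have hmul : MDifferentiableAt (𝓡 n) (𝓡 n) (fun x : G => g * x) 1 :=
    ((contMDiff_mul_left (I := 𝓡 n) (n := ∞) (a := g)) 1).mdifferentiableAt (by simp)
  have hV1 : MDifferentiableAt (𝓡 n) 𝓘(ℝ, ℝ) (fun x : G => V (g * x)) 1 := by
    refine MDifferentiableAt.comp (g := V) (1 : G) ?_ hmul
    rwa [mul_one]
  have hV2 : HasMFDerivAt (𝓡 n) 𝓘(ℝ, ℝ) (fun x : G => V (g * x)) (σ 0)
      (mfderiv (𝓡 n) 𝓘(ℝ, ℝ) (fun x : G => V (g * x)) 1) := by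
    rw [hσ.zero]; exact hV1.hasMFDerivAt
  have h2 := (hV2.comp (0 : Fin n → ℝ) hσ.hasMFDerivAt).hasFDerivAt
  -- The tangent vector dσ(e_i) is the one identified with Λ e_i, so both gradients evaluate the
  -- same differential on the same vector.
  have h3 : (tangentEquiv hι).symm (Lam E (Pi.single i 1)) = paramDeriv σ (Pi.single i 1) := by
    refine (LinearEquiv.symm_apply_eq _).2 (Subtype.ext ?_)
    exact (hσ.tangentMap_paramDeriv hι (Pi.single i 1)).symm
  have h4 := congrArg (fun A : (Fin n → ℝ) →L[ℝ] ℝ => A (Pi.single i 1))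
    (HasFDerivAt.fderiv h2)
  refine Eq.trans ?_ h4.symm
  exact congrArg (mfderiv (𝓡 n) 𝓘(ℝ, ℝ) (fun x : G => V (g * x)) 1) h3

end Derivatives

end LieAdjoint

namespace LieAdjoint

variable {n m p : ℕ} {G : Type*} [TopologicalSpace G]
  [ChartedSpace (EuclideanSpace ℝ (Fin n)) G] [Group G]

/-! ### The relative vector field and its linearization -/

section Field

variable {ι : G →* GL (Fin m) ℝ} (E : Module.Basis (Fin n) ℝ (lieAlg (n := n) ι))
  (f : G → ℝ → EuclideanSpace ℝ (Fin p) → Matrix (Fin m) (Fin m) ℝ)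

/-- The left-trivialized vector field in coordinates, `Λ⁻¹(g⁻¹ f_θ(g, t))`. -/
def coordField (g : G) (t : ℝ) (θ : EuclideanSpace ℝ (Fin p)) : Fin n → ℝ :=
  coordProj E (toMat ι g⁻¹ * f g t θ)

variable {E f}

theorem symm_leftTriv (hf : IsTangent (n := n) ι f) (g : G) (t : ℝ)
    (θ : EuclideanSpace ℝ (Fin p)) :
    (Lam E).symm (leftTriv hf g t θ) = coordField E f g t θ :=
  (coordProj_coe E (leftTriv hf g t θ)).symm

theorem matLam_coordField (hf : IsTangent (n := n) ι f) (g : G) (t : ℝ)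
    (θ : EuclideanSpace ℝ (Fin p)) :
    matLam E (coordField E f g t θ) = toMat ι g⁻¹ * f g t θ :=
  matLam_coordProj E (hf g t θ)

theorem _root_.ContMDiffAt.matrix_mul {E₀ : Type*} [NormedAddCommGroup E₀] [NormedSpace ℝ E₀]
    {H : Type*} [TopologicalSpace H] {I : ModelWithCorners ℝ E₀ H} {N : Type*}
    [TopologicalSpace N] [ChartedSpace H N] {k : WithTop ℕ∞}
    {A B : N → Matrix (Fin m) (Fin m) ℝ} {z : N}
    (hA : ContMDiffAt I 𝓘(ℝ, Matrix (Fin m) (Fin m) ℝ) k A z)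
    (hB : ContMDiffAt I 𝓘(ℝ, Matrix (Fin m) (Fin m) ℝ) k B z) :
    ContMDiffAt I 𝓘(ℝ, Matrix (Fin m) (Fin m) ℝ) k (fun x => A x * B x) z := by
  have h : ContDiff ℝ k
      (fun q : Matrix (Fin m) (Fin m) ℝ × Matrix (Fin m) (Fin m) ℝ => q.1 * q.2) :=
    contDiff_fst.mul contDiff_snd
  exact ContMDiffAt.comp z (h.contMDiff (A z, B z)) (hA.prodMk_space hB)

theorem contMDiff_coordField [LieGroup (𝓡 n) ∞ G] (hι : IsMatrixLieGroup (n := n) ι)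
    (hf1 : ContMDiff ((𝓡 n).prod (𝓘(ℝ, ℝ).prod 𝓘(ℝ, EuclideanSpace ℝ (Fin p))))
      𝓘(ℝ, Matrix (Fin m) (Fin m) ℝ) 1
      (fun x : G × ℝ × EuclideanSpace ℝ (Fin p) => f x.1 x.2.1 x.2.2)) :
    ContMDiff ((𝓡 n).prod (𝓘(ℝ, ℝ).prod 𝓘(ℝ, EuclideanSpace ℝ (Fin p)))) 𝓘(ℝ, Fin n → ℝ) 1
      (fun x : G × ℝ × EuclideanSpace ℝ (Fin p) => coordField E f x.1 x.2.1 x.2.2) := by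
  have hJ : ContMDiff (𝓡 n) 𝓘(ℝ, Matrix (Fin m) (Fin m) ℝ) 1 (fun g : G => toMat ι g⁻¹) :=
    (hι.contMDiff.comp (contMDiff_inv (𝓡 n) ∞)).of_le (by simp)
  intro x
  have h1 : ContMDiffAt ((𝓡 n).prod (𝓘(ℝ, ℝ).prod 𝓘(ℝ, EuclideanSpace ℝ (Fin p))))
      𝓘(ℝ, Matrix (Fin m) (Fin m) ℝ) 1
      (fun x : G × ℝ × EuclideanSpace ℝ (Fin p) => toMat ι x.1⁻¹) x :=
    (hJ.comp contMDiff_fst) x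
  exact ((coordProj E).contDiff.contMDiff _).comp x (h1.matrix_mul (hf1 x))

/-- A `C¹` function on `G × ℝ × ℝᵖ`, read in the local parametrization `x ↦ g σ(x)`. -/
theorem IsLocalParam.contMDiffAt_comp [LieGroup (𝓡 n) ∞ G] {σ : (Fin n → ℝ) → G}
    (hσ : IsLocalParam E σ) {W : Type*} [NormedAddCommGroup W] [NormedSpace ℝ W]
    {V : G → ℝ → EuclideanSpace ℝ (Fin p) → W}
    (hV : ContMDiff ((𝓡 n).prod (𝓘(ℝ, ℝ).prod 𝓘(ℝ, EuclideanSpace ℝ (Fin p)))) 𝓘(ℝ, W) 1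
      (fun x : G × ℝ × EuclideanSpace ℝ (Fin p) => V x.1 x.2.1 x.2.2))
    (z : G × ℝ) (θ : EuclideanSpace ℝ (Fin p)) :
    ContMDiffAt (((𝓡 n).prod 𝓘(ℝ, ℝ)).prod 𝓘(ℝ, (Fin n → ℝ) × EuclideanSpace ℝ (Fin p)))
      𝓘(ℝ, W) 1
      (Function.uncurry fun (z : G × ℝ) (u : (Fin n → ℝ) × EuclideanSpace ℝ (Fin p)) =>
        V (z.1 * σ u.1) z.2 u.2) (z, (0, θ)) := by
  have hx : ContMDiffAt
      (((𝓡 n).prod 𝓘(ℝ, ℝ)).prod 𝓘(ℝ, (Fin n → ℝ) × EuclideanSpace ℝ (Fin p)))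
      𝓘(ℝ, Fin n → ℝ) 1
      (fun q : (G × ℝ) × ((Fin n → ℝ) × EuclideanSpace ℝ (Fin p)) => q.2.1) (z, (0, θ)) :=
    (contDiff_fst.contMDiff.comp contMDiff_snd) _
  have hθ : ContMDiffAt
      (((𝓡 n).prod 𝓘(ℝ, ℝ)).prod 𝓘(ℝ, (Fin n → ℝ) × EuclideanSpace ℝ (Fin p)))
      𝓘(ℝ, EuclideanSpace ℝ (Fin p)) 1
      (fun q : (G × ℝ) × ((Fin n → ℝ) × EuclideanSpace ℝ (Fin p)) => q.2.2) (z, (0, θ)) :=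
    (contDiff_snd.contMDiff.comp contMDiff_snd) _
  have hsx := ContMDiffAt.comp (g := σ) (z, ((0 : Fin n → ℝ), θ)) hσ.contMDiffAt hx
  have hg : ContMDiffAt
      (((𝓡 n).prod 𝓘(ℝ, ℝ)).prod 𝓘(ℝ, (Fin n → ℝ) × EuclideanSpace ℝ (Fin p)))
      (𝓡 n) 1
      (fun q : (G × ℝ) × ((Fin n → ℝ) × EuclideanSpace ℝ (Fin p)) => q.1.1) (z, (0, θ)) :=
    (contMDiff_fst.comp contMDiff_fst) _
  have ht : ContMDiffAt
      (((𝓡 n).prod 𝓘(ℝ, ℝ)).prod 𝓘(ℝ, (Fin n → ℝ) × EuclideanSpace ℝ (Fin p)))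
      𝓘(ℝ, ℝ) 1
      (fun q : (G × ℝ) × ((Fin n → ℝ) × EuclideanSpace ℝ (Fin p)) => q.1.2) (z, (0, θ)) :=
    (contMDiff_snd.comp contMDiff_fst) _
  have : ContMDiffMul (𝓡 n) 1 G := ContMDiffMul.of_le (n := ∞) (by simp)
  exact ContMDiffAt.comp (g := fun x : G × ℝ × EuclideanSpace ℝ (Fin p) => V x.1 x.2.1 x.2.2)
    (z, ((0 : Fin n → ℝ), θ)) (hV _) ((hg.mul hsx).prodMk (ht.prodMk hθ))

variable (E f) in
/-- The velocity of the coordinates of `γ⁻¹ h` for two state solutions `γ` and `h` with parameters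
`θ` and `θ'`, as a function of `z = (γ(t), t)`, these coordinates and `θ'`. -/
def relField (σ : (Fin n → ℝ) → G) (θ : EuclideanSpace ℝ (Fin p)) (z : G × ℝ)
    (u : (Fin n → ℝ) × EuclideanSpace ℝ (Fin p)) : Fin n → ℝ :=
  coordProj E (toMat ι (σ u.1) * matLam E (coordField E f (z.1 * σ u.1) z.2 u.2)
    - matLam E (coordField E f z.1 z.2 θ) * toMat ι (σ u.1))

/-- Two equal solutions have no relative motion; hence the expansions of the field at (0, θ) have no
constant term. -/
theorem IsLocalParam.relField_base {σ : (Fin n → ℝ) → G} (hσ : IsLocalParam E σ)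
    (θ : EuclideanSpace ℝ (Fin p)) (z : G × ℝ) : relField E f σ θ z (0, θ) = 0 := by
  simp [relField, hσ.zero, toMat_one]

theorem IsLocalParam.contMDiffAt_relField [LieGroup (𝓡 n) ∞ G] {σ : (Fin n → ℝ) → G}
    (hσ : IsLocalParam E σ) (hι : IsMatrixLieGroup (n := n) ι)
    (hf1 : ContMDiff ((𝓡 n).prod (𝓘(ℝ, ℝ).prod 𝓘(ℝ, EuclideanSpace ℝ (Fin p))))
      𝓘(ℝ, Matrix (Fin m) (Fin m) ℝ) 1
      (fun x : G × ℝ × EuclideanSpace ℝ (Fin p) => f x.1 x.2.1 x.2.2))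
    (z : G × ℝ) (θ : EuclideanSpace ℝ (Fin p)) :
    ContMDiffAt (((𝓡 n).prod 𝓘(ℝ, ℝ)).prod 𝓘(ℝ, (Fin n → ℝ) × EuclideanSpace ℝ (Fin p)))
      𝓘(ℝ, Fin n → ℝ) 1 (Function.uncurry (relField E f σ θ)) (z, (0, θ)) := by
  have hfc := contMDiff_coordField (E := E) hι hf1
  have h1 := hσ.contMDiffAt_comp hfc z θ
  have hx : ContMDiffAt
      (((𝓡 n).prod 𝓘(ℝ, ℝ)).prod 𝓘(ℝ, (Fin n → ℝ) × EuclideanSpace ℝ (Fin p)))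
      𝓘(ℝ, Fin n → ℝ) 1
      (fun q : (G × ℝ) × ((Fin n → ℝ) × EuclideanSpace ℝ (Fin p)) => q.2.1) (z, (0, θ)) :=
    (contDiff_fst.contMDiff.comp contMDiff_snd) _
  have hsx := ContMDiffAt.comp (g := σ) (z, ((0 : Fin n → ℝ), θ)) hσ.contMDiffAt hx
  have hJ := ContMDiffAt.comp (g := toMat ι) (z, ((0 : Fin n → ℝ), θ))
    ((hι.contMDiff.of_le (m := 1) (by simp)) _) hsx
  have hz : ContMDiffAt
      (((𝓡 n).prod 𝓘(ℝ, ℝ)).prod 𝓘(ℝ, (Fin n → ℝ) × EuclideanSpace ℝ (Fin p)))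
      ((𝓡 n).prod (𝓘(ℝ, ℝ).prod 𝓘(ℝ, EuclideanSpace ℝ (Fin p)))) 1
      (fun q : (G × ℝ) × ((Fin n → ℝ) × EuclideanSpace ℝ (Fin p)) => (q.1.1, q.1.2, θ))
      (z, (0, θ)) :=
    ((contMDiff_fst.comp contMDiff_fst).prodMk
      ((contMDiff_snd.comp contMDiff_fst).prodMk contMDiff_const)) _
  have h2 := ContMDiffAt.comp (z, ((0 : Fin n → ℝ), θ)) (hfc _) hz
  have hL : ∀ w, ContMDiffAt 𝓘(ℝ, Fin n → ℝ) 𝓘(ℝ, Matrix (Fin m) (Fin m) ℝ) 1 (matLam E) w :=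
    (matLam E).contDiff.contMDiff
  have h3 := hJ.matrix_mul (ContMDiffAt.comp (z, ((0 : Fin n → ℝ), θ)) (hL _) h1)
  have h4 := (ContMDiffAt.comp (z, ((0 : Fin n → ℝ), θ)) (hL _) h2).matrix_mul hJ
  exact ((coordProj E).contDiff.contMDiff _).comp (z, ((0 : Fin n → ℝ), θ)) (h3.sub h4)

/-- Puts ad into the form in which the commutator arises when the matrix products in `relField` are
differentiated. -/
theorem adMatrix_mulVec [LieGroup (𝓡 n) ∞ G] (hι : IsMatrixLieGroup (n := n) ι)
    (A : lieAlg (n := n) ι) (x : Fin n → ℝ) :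
    adMatrix hι E A *ᵥ x =
      coordProj E ((A : Matrix (Fin m) (Fin m) ℝ) * matLam E x - matLam E x * A) := by
  let φ : (Fin n → ℝ) →ₗ[ℝ] (Fin n → ℝ) := (coordProj E).toLinearMap ∘ₗ
    (LinearMap.mulLeft ℝ (A : Matrix (Fin m) (Fin m) ℝ) -
      LinearMap.mulRight ℝ (A : Matrix (Fin m) (Fin m) ℝ)) ∘ₗ (matLam E).toLinearMap
  have h : adMatrix hι E A = LinearMap.toMatrix' φ := by
    ext i j
    rw [LinearMap.toMatrix'_apply, adMatrix, Matrix.of_apply, ← coordProj_coe]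
    simp [φ, adMap, matLam_apply]
  rw [h, LinearMap.toMatrix'_mulVec]
  rfl

theorem _root_.ContMDiffAt.differentiableAt_snd {E₀ : Type*} [NormedAddCommGroup E₀]
    [NormedSpace ℝ E₀] {H : Type*} [TopologicalSpace H] {I : ModelWithCorners ℝ E₀ H} {N : Type*}
    [TopologicalSpace N] [ChartedSpace H N] [IsManifold I 1 N]
    {V : Type*} [NormedAddCommGroup V] [NormedSpace ℝ V]
    {W : Type*} [NormedAddCommGroup W] [NormedSpace ℝ W] {Φ : N → V → W} {z : N}
    {u : V} (h : ContMDiffAt (I.prod 𝓘(ℝ, V)) 𝓘(ℝ, W) 1 (Function.uncurry Φ) (z, u)) :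
    DifferentiableAt ℝ (Φ z) u :=
  h.eventually_differentiableAt_snd.self_of_nhds

/-- The linearization of the relative field: the derivative of the field minus `ad`. -/
theorem IsLocalParam.fderiv_relField [LieGroup (𝓡 n) ∞ G] {σ : (Fin n → ℝ) → G}
    (hσ : IsLocalParam E σ) (hι : IsMatrixLieGroup (n := n) ι) (hf : IsTangent (n := n) ι f)
    (hf1 : ContMDiff ((𝓡 n).prod (𝓘(ℝ, ℝ).prod 𝓘(ℝ, EuclideanSpace ℝ (Fin p))))
      𝓘(ℝ, Matrix (Fin m) (Fin m) ℝ) 1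
      (fun x : G × ℝ × EuclideanSpace ℝ (Fin p) => f x.1 x.2.1 x.2.2))
    (z : G × ℝ) (θ : EuclideanSpace ℝ (Fin p))
    (u : (Fin n → ℝ) × EuclideanSpace ℝ (Fin p)) :
    fderiv ℝ (relField E f σ θ z) (0, θ) u =
      fderiv ℝ (fun u : (Fin n → ℝ) × EuclideanSpace ℝ (Fin p) =>
        coordField E f (z.1 * σ u.1) z.2 u.2) (0, θ) u
      - adMatrix hι E (leftTriv hf z.1 z.2 θ) *ᵥ u.1 := by
  have hΦ := ((hσ.contMDiffAt_comp (contMDiff_coordField (E := E) hι hf1)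
    z θ).differentiableAt_snd).hasFDerivAt
  have hfst : HasFDerivAt (fun u : (Fin n → ℝ) × EuclideanSpace ℝ (Fin p) => u.1)
      (ContinuousLinearMap.fst ℝ (Fin n → ℝ) (EuclideanSpace ℝ (Fin p)))
      ((0 : Fin n → ℝ), θ) := hasFDerivAt_fst
  have hJ := HasFDerivAt.comp ((0 : Fin n → ℝ), θ) (f := Prod.fst) (hσ.hasFDerivAt_toMat hι) hfst
  -- Product rule: σ varies on both sides of the difference, with derivative Λ at 0. The σ-terms are
  -- (Λx)ξ − ξ(Λx), that is −ad_ξ x in coordinates.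
  have h1 := hJ.mul' ((matLam E).hasFDerivAt.comp ((0 : Fin n → ℝ), θ) hΦ)
  have h2 := hJ.const_mul (matLam E (coordField E f z.1 z.2 θ))
  have h3 := (coordProj E).hasFDerivAt.comp ((0 : Fin n → ℝ), θ) (h1.sub h2)
  have h4 : HasFDerivAt (relField E f σ θ z) _ (0, θ) := h3
  rw [h4.fderiv, adMatrix_mulVec]
  simp [hσ.zero, toMat_one, coordProj_matLam, leftTriv, matLam_coordField hf]
  abel

end Field

end LieAdjoint

/-! ### Relative motion of two solutions and its Grönwall estimate -/

namespace LieAdjoint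

variable {n m p : ℕ} {G : Type*} [TopologicalSpace G]
  [ChartedSpace (EuclideanSpace ℝ (Fin n)) G] [Group G]
  {ι : G →* GL (Fin m) ℝ} {E : Module.Basis (Fin n) ℝ (lieAlg (n := n) ι)}
  {f : G → ℝ → EuclideanSpace ℝ (Fin p) → Matrix (Fin m) (Fin m) ℝ}
  {σ : (Fin n → ℝ) → G} {T : ℝ} {g₀ : G} {θ θ' : EuclideanSpace ℝ (Fin p)} {γ h : ℝ → G}

/-- Allows γ⁻¹ to be differentiated through inversion in the normed ring of matrices. -/
theorem toMat_inv_eq_ringInverse {H : Type*} [Group H] (ι : H →* GL (Fin m) ℝ) (g : H) :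
    toMat ι g⁻¹ = Ring.inverse (toMat ι g) := by
  simp only [toMat, map_inv, Ring.inverse_unit]

theorem IsStateSolution.hasDerivWithinAt_inv (hγ : IsStateSolution ι f T g₀ θ γ) {t : ℝ}
    (ht : t ∈ Icc 0 T) :
    HasDerivWithinAt (fun s => toMat ι (γ s)⁻¹)
      (-(toMat ι (γ t)⁻¹ * f (γ t) t θ * toMat ι (γ t)⁻¹)) (Icc 0 T) t := by
  have h1 : HasFDerivAt (Ring.inverse : Matrix (Fin m) (Fin m) ℝ → _) _ (toMat ι (γ t)) :=
    hasFDerivAt_ringInverse (𝕜 := ℝ) (ι (γ t))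
  have h2 := h1.comp_hasDerivWithinAt t (hγ.hasDeriv t ht)
  have h3 : (fun s => toMat ι (γ s)⁻¹) = Ring.inverse ∘ fun s => toMat ι (γ s) := by
    funext s; exact toMat_inv_eq_ringInverse ι (γ s)
  rw [h3]
  refine h2.congr_deriv ?_
  simp [toMat]

/-- The relative motion `γ⁻¹ h` of two state solutions. -/
theorem hasDerivWithinAt_toMat_inv_mul (hf : IsTangent (n := n) ι f)
    (hγ : IsStateSolution ι f T g₀ θ γ) (hh : IsStateSolution ι f T g₀ θ' h) {t : ℝ}
    (ht : t ∈ Icc 0 T) :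
    HasDerivWithinAt (fun s => toMat ι ((γ s)⁻¹ * h s))
      (toMat ι ((γ t)⁻¹ * h t) * matLam E (coordField E f (h t) t θ')
        - matLam E (coordField E f (γ t) t θ) * toMat ι ((γ t)⁻¹ * h t)) (Icc 0 T) t := by
  have h1 := (hγ.hasDerivWithinAt_inv ht).mul (hh.hasDeriv t ht)
  have h3 : (fun s => toMat ι ((γ s)⁻¹ * h s)) =
      (fun s => toMat ι (γ s)⁻¹) * fun s => toMat ι (h s) := by
    funext s; exact toMat_mul ι _ _
  rw [h3]
  refine h1.congr_deriv ?_
  -- Inserting h h⁻¹ = 1 turns γ⁻¹ f(h) into (γ⁻¹h)(h⁻¹ f(h)).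
  rw [matLam_coordField hf, matLam_coordField hf, toMat_mul, mul_assoc (toMat ι (γ t)⁻¹)
    (toMat ι (h t)), ← mul_assoc (toMat ι (h t)), toMat_mul_inv, one_mul]
  noncomm_ring

/-- The coordinates are an affine function of the matrix, defined on all of G, so no closeness to
the identity is needed here. -/
theorem hasDerivWithinAt_coordAtOne (hf : IsTangent (n := n) ι f)
    (hγ : IsStateSolution ι f T g₀ θ γ) (hh : IsStateSolution ι f T g₀ θ' h) {t : ℝ}
    (ht : t ∈ Icc 0 T) :
    HasDerivWithinAt (fun s => coordAtOne E ((γ s)⁻¹ * h s))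
      (coordProj E (toMat ι ((γ t)⁻¹ * h t) * matLam E (coordField E f (h t) t θ')
        - matLam E (coordField E f (γ t) t θ) * toMat ι ((γ t)⁻¹ * h t))) (Icc 0 T) t :=
  (coordProj E).hasFDerivAt.comp_hasDerivWithinAt t
    ((hasDerivWithinAt_toMat_inv_mul hf hγ hh ht).sub_const 1)

/-- As long as `γ⁻¹ h` is in the range of the local parametrization, its coordinates move with
velocity `relField`. -/
theorem hasDerivWithinAt_coordAtOne_of_param (hf : IsTangent (n := n) ι f)
    (hγ : IsStateSolution ι f T g₀ θ γ) (hh : IsStateSolution ι f T g₀ θ' h) {t : ℝ}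
    (ht : t ∈ Icc 0 T)
    (hk : σ (coordAtOne E ((γ t)⁻¹ * h t)) = (γ t)⁻¹ * h t) :
    HasDerivWithinAt (fun s => coordAtOne E ((γ s)⁻¹ * h s))
      (relField E f σ θ (γ t, t) (coordAtOne E ((γ t)⁻¹ * h t), θ')) (Icc 0 T) t := by
  refine (hasDerivWithinAt_coordAtOne hf hγ hh ht).congr_deriv ?_
  simp only [relField]
  rw [hk, mul_inv_cancel_left]

theorem continuousOn_inv_mul [IsTopologicalGroup G] (hγ : IsStateSolution ι f T g₀ θ γ)
    (hh : IsStateSolution ι f T g₀ θ' h) : ContinuousOn (fun s => (γ s)⁻¹ * h s) (Icc 0 T) :=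
  hγ.continuousOn.inv.mul hh.continuousOn

/-- The compact set `{(γ(t), t)}`. -/
theorem isCompact_graph (hγ : IsStateSolution ι f T g₀ θ γ) :
    IsCompact ((fun t => (γ t, t)) '' Icc 0 T) :=
  isCompact_Icc.image_of_continuousOn (hγ.continuousOn.prodMk continuousOn_id)

/-- A closed neighborhood of the identity on which the local coordinates are valid. -/
theorem IsLocalParam.exists_closed_nhds (hι : IsMatrixLieGroup (n := n) ι)
    [IsManifold (𝓡 n) ∞ G]
    (hσ : IsLocalParam E σ) {ρ : ℝ} (hρ : 0 < ρ) :
    ∃ ρ' ∈ Ioc 0 ρ, ∃ C : Set G, IsClosed C ∧ 1 ∈ C ∧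
      (∀ k ∈ C, σ (coordAtOne E k) = k ∧ ‖coordAtOne E k‖ ≤ ρ') ∧
      ∀ k ∈ C, ‖coordAtOne E k‖ < ρ' → k ∈ interior C := by
  have hJc : Continuous (toMat ι) := hι.contMDiff.continuous
  have : T2Space G := by
    -- G injects continuously into the matrices, hence is Hausdorff; this makes the compact image of
    -- a closed ball under σ closed.
    refine T2Space.of_injective_continuous (f := toMat ι) (fun a b hab => ?_) hJc
    exact hι.injective (Units.ext hab)
  have hηc : Continuous (coordAtOne E : G → Fin n → ℝ) := (contMDiff_coordAtOne hι E).continuous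
  obtain ⟨W, hWsub, hWo, h1W⟩ := eventually_nhds_iff.1 hσ.left_inv
  have hσ0 : ContinuousAt σ 0 := hσ.contMDiffAt.continuousAt
  have hσW : ∀ᶠ x in 𝓝 0, σ x ∈ W := by
    refine hσ0 (hWo.mem_nhds ?_)
    rwa [hσ.zero]
  have hσc : ∀ᶠ x in 𝓝 0, ContinuousAt σ x :=
    ((contMDiffAt_iff_contMDiffAt_nhds (by simp)).1 hσ.contMDiffAt).mono fun x hx => hx.continuousAt
  obtain ⟨ε, hε, hball⟩ := Metric.eventually_nhds_iff_ball.1 (hσW.and (hσc.and hσ.right_inv))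
  set ρ' := min ρ (ε / 2) with hρ'
  have hρ'0 : 0 < ρ' := lt_min hρ (by positivity)
  have hsub : ∀ x ∈ Metric.closedBall (0 : Fin n → ℝ) ρ', x ∈ Metric.ball (0 : Fin n → ℝ) ε :=
    fun x hx => (Metric.mem_closedBall.1 hx).trans_lt
      ((min_le_right _ _).trans_lt (by linarith))
  refine ⟨ρ', ⟨hρ'0, min_le_left _ _⟩, σ '' Metric.closedBall 0 ρ', ?_, ?_, ?_, ?_⟩
  · exact ((isCompact_closedBall _ _).image_of_continuousOn fun x hx =>
      (hball x (hsub x hx)).2.1.continuousWithinAt).isClosed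
  · exact ⟨0, Metric.mem_closedBall_self hρ'0.le, hσ.zero⟩
  · rintro _ ⟨x, hx, rfl⟩
    rw [(hball x (hsub x hx)).2.2]
    exact ⟨rfl, by simpa using hx⟩
  · rintro _ ⟨x, hx, rfl⟩ hlt
    -- On W one has σ ∘ `coordAtOne` = id, so every k in W with coordinates of norm below ρ' is in
    -- the image of the ball.
    refine mem_interior.2 ⟨W ∩ {k | ‖coordAtOne E k‖ < ρ'}, ?_,
      hWo.inter (isOpen_lt hηc.norm continuous_const), (hball x (hsub x hx)).1, hlt⟩
    rintro k ⟨hkW, hk⟩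
    exact ⟨coordAtOne E k, by simpa using hk.le, hWsub k hkW⟩

/-- State solutions with parameters near `θ` stay close to the solution with parameter `θ`:
the coordinates of `γ⁻¹ h` are defined and are `O(‖θ' - θ‖)`. -/
theorem IsStateSolution.exists_norm_coordAtOne_le [LieGroup (𝓡 n) ∞ G]
    (hι : IsMatrixLieGroup (n := n) ι) (hσ : IsLocalParam E σ) (hf : IsTangent (n := n) ι f)
    (hf1 : ContMDiff ((𝓡 n).prod (𝓘(ℝ, ℝ).prod 𝓘(ℝ, EuclideanSpace ℝ (Fin p))))
      𝓘(ℝ, Matrix (Fin m) (Fin m) ℝ) 1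
      (fun x : G × ℝ × EuclideanSpace ℝ (Fin p) => f x.1 x.2.1 x.2.2))
    (hγ : IsStateSolution ι f T g₀ θ γ) :
    ∃ C : ℝ, 0 ≤ C ∧ ∀ᶠ θ' in 𝓝 θ, ∀ h : ℝ → G, IsStateSolution ι f T g₀ θ' h →
      ∀ t ∈ Icc 0 T, σ (coordAtOne E ((γ t)⁻¹ * h t)) = (γ t)⁻¹ * h t ∧
        ‖coordAtOne E ((γ t)⁻¹ * h t)‖ ≤ C * ‖θ' - θ‖ := by
  have hTG : IsTopologicalGroup G := topologicalGroup_of_lieGroup (𝓡 n) ∞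
  have hK := isCompact_graph hγ
  have hC1 := fun z => hσ.contMDiffAt_relField hι hf1 z θ
  have hexp := hK.eventually_norm_sub_fderiv_le (u₀ := ((0 : Fin n → ℝ), θ))
    (fun z _ => hC1 z) zero_lt_one
  obtain ⟨B, hB⟩ := hK.exists_bound_of_continuousOn
    (f := fun z => fderiv ℝ (relField E f σ θ z) (0, θ)) fun z _ =>
      (ContinuousAt.comp (f := fun z : G × ℝ => (z, ((0 : Fin n → ℝ), θ)))
        (hC1 z).continuousAt_fderiv_snd
        (by fun_prop)).continuousWithinAt
  rw [nhds_prod_eq] at hexp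
  obtain ⟨p₁, hp₁, p₂, hp₂, hp⟩ := eventually_prod_iff.1 hexp
  obtain ⟨ρ, hρ, hball⟩ := Metric.eventually_nhds_iff_ball.1 hp₁
  -- Asking for ρ' ≤ ρ/2 places the coordinates of the closed set S in the open ball of radius ρ on
  -- which the expansion holds.
  obtain ⟨ρ', hρ', S, hS, h1S, hSσ, hSint⟩ := hσ.exists_closed_nhds hι (half_pos hρ)
  -- M bounds the linear part plus the remainder, the latter taken with constant 1. The maximum is
  -- needed because B has no sign when the interval is empty.
  set M : ℝ := max B 0 + 1 with hM
  have hM0 : 0 < M := by positivity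
  -- From y(0) = 0 and ‖y'‖ ≤ M‖y‖ + M‖θ' − θ‖, Grönwall gives ‖y(t)‖ ≤ (e^{Mt} − 1)‖θ' − θ‖.
  refine ⟨Real.exp (M * T), (Real.exp_pos _).le, ?_⟩
  have hnear : ∀ᶠ θ' in 𝓝 θ, Real.exp (M * T) * ‖θ' - θ‖ < ρ' := by
    have hc : ContinuousAt (fun θ' => Real.exp (M * T) * ‖θ' - θ‖) θ := by fun_prop
    exact hc.eventually (gt_mem_nhds (by simpa using hρ'.1))
  filter_upwards [hp₂, hnear] with θ' hθ' hnear h hh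
  have hk := continuousOn_inv_mul hγ hh
  have hgron : ∀ t ∈ Icc 0 T, (∀ s ∈ Icc 0 t, (γ s)⁻¹ * h s ∈ S) →
      ‖coordAtOne E ((γ t)⁻¹ * h t)‖ ≤ Real.exp (M * T) * ‖θ' - θ‖ := by
    intro t ht hs
    have hsubt : Icc 0 t ⊆ Icc 0 T := Icc_subset_Icc_right ht.2
    have hder : ∀ s ∈ Icc 0 t, HasDerivWithinAt (fun s => coordAtOne E ((γ s)⁻¹ * h s))
        (relField E f σ θ (γ s, s) (coordAtOne E ((γ s)⁻¹ * h s), θ')) (Icc 0 t) s :=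
      fun s hst => (hasDerivWithinAt_coordAtOne_of_param hf hγ hh (hsubt hst)
        (hSσ _ (hs s hst)).1).mono hsubt
    have hg := norm_le_gronwallBound_of_norm_deriv_right_le (δ := 0) (K := M)
      (ε := M * ‖θ' - θ‖)
      (fun s hst => (hder s hst).continuousWithinAt)
      (fun s hst => (hder s (Ico_subset_Icc_self hst)).Icc_to_Ici hst)
      (by simp [hγ.init, hh.init, coordAtOne_one]) (fun s hst => ?_) t ⟨ht.1, le_rfl⟩
    · refine hg.trans ?_
      rw [gronwallBound_of_K_ne_0 hM0.ne', sub_zero]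
      beta_reduce
      rw [zero_mul, zero_add, mul_div_cancel_left₀ _ hM0.ne', mul_comm]
      refine mul_le_mul_of_nonneg_right ?_ (norm_nonneg _)
      have : Real.exp (M * t) ≤ Real.exp (M * T) :=
        Real.exp_le_exp.2 (mul_le_mul_of_nonneg_left ht.2 hM0.le)
      linarith
    · have hst' := Ico_subset_Icc_self hst
      have hy := (hSσ _ (hs s hst')).2
      set y := coordAtOne E ((γ s)⁻¹ * h s) with hydef
      have hz : (γ s, s) ∈ (fun t => (γ t, t)) '' Icc 0 T := ⟨s, hsubt hst', rfl⟩
      have hyb : y ∈ Metric.ball (0 : Fin n → ℝ) ρ := by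
        rw [mem_ball_zero_iff]
        exact (hy.trans hρ'.2).trans_lt (by linarith)
      have e1 := hp (hball y hyb) hθ' (γ s, s) hz
      rw [hσ.relField_base, sub_zero] at e1
      have e2 := (fderiv ℝ (relField E f σ θ (γ s, s)) (0, θ)).le_of_opNorm_le
        ((hB _ hz).trans (le_max_left B 0)) ((y, θ') - ((0 : Fin n → ℝ), θ))
      have e3 : ‖(y, θ') - ((0 : Fin n → ℝ), θ)‖ ≤ ‖y‖ + ‖θ' - θ‖ := by
        rw [Prod.mk_sub_mk, sub_zero, Prod.norm_def]
        exact max_le_add_of_nonneg (norm_nonneg _) (norm_nonneg _)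
      calc ‖relField E f σ θ (γ s, s) (y, θ')‖
          ≤ ‖relField E f σ θ (γ s, s) (y, θ') - fderiv ℝ (relField E f σ θ (γ s, s)) (0, θ)
              ((y, θ') - ((0 : Fin n → ℝ), θ))‖ + ‖fderiv ℝ (relField E f σ θ (γ s, s)) (0, θ)
              ((y, θ') - ((0 : Fin n → ℝ), θ))‖ := by
            simpa using norm_add_le (relField E f σ θ (γ s, s) (y, θ')
              - fderiv ℝ (relField E f σ θ (γ s, s)) (0, θ) ((y, θ') - ((0 : Fin n → ℝ), θ)))
              (fderiv ℝ (relField E f σ θ (γ s, s)) (0, θ) ((y, θ') - ((0 : Fin n → ℝ), θ)))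
        _ ≤ 1 * ‖(y, θ') - ((0 : Fin n → ℝ), θ)‖ + max B 0 * ‖(y, θ') - ((0 : Fin n → ℝ), θ)‖ :=
            add_le_add e1 e2
        _ = M * ‖(y, θ') - ((0 : Fin n → ℝ), θ)‖ := by rw [hM]; ring
        _ ≤ M * (‖y‖ + ‖θ' - θ‖) := mul_le_mul_of_nonneg_left e3 hM0.le
        _ = M * ‖y‖ + M * ‖θ' - θ‖ := by ring
  have hmem : ∀ t ∈ Icc 0 T, (γ t)⁻¹ * h t ∈ S := by
    -- The estimate holds as long as k stays in S, and it is strictly below ρ', which puts k in the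
    -- interior of S; so k never leaves.
    refine forall_mem_of_bootstrap hk hS (by simpa [hγ.init, hh.init] using h1S) fun t ht hs => ?_
    exact hSint _ (hs t ⟨ht.1, le_rfl⟩) ((hgron t ht hs).trans_lt hnear)
  intro t ht
  exact ⟨(hSσ _ (hmem t ht)).1, hgron t ht fun s hs => hmem s ⟨hs.1, hs.2.trans ht.2⟩⟩

/-- The bound C‖θ' − θ‖ at θ' = θ forces the coordinates of γ⁻¹h to vanish, so γ⁻¹h = σ(0) = 1. -/
theorem IsStateSolution.eqOn [LieGroup (𝓡 n) ∞ G]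
    (hι : IsMatrixLieGroup (n := n) ι) (hσ : IsLocalParam E σ) (hf : IsTangent (n := n) ι f)
    (hf1 : ContMDiff ((𝓡 n).prod (𝓘(ℝ, ℝ).prod 𝓘(ℝ, EuclideanSpace ℝ (Fin p))))
      𝓘(ℝ, Matrix (Fin m) (Fin m) ℝ) 1
      (fun x : G × ℝ × EuclideanSpace ℝ (Fin p) => f x.1 x.2.1 x.2.2))
    (hγ : IsStateSolution ι f T g₀ θ γ) (hh : IsStateSolution ι f T g₀ θ h) :
    EqOn h γ (Icc 0 T) := by
  obtain ⟨C, -, hC⟩ := hγ.exists_norm_coordAtOne_le hι hσ hf hf1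
  intro t ht
  obtain ⟨h1, h2⟩ := hC.self_of_nhds h hh t ht
  rw [sub_self, norm_zero, mul_zero, norm_le_zero_iff] at h2
  rw [h2, hσ.zero] at h1
  exact (inv_mul_eq_one.1 h1.symm).symm

end LieAdjoint

/-! ### The adjoint equation and the gradient integrand as transposed linearization -/

namespace LieAdjoint

variable {n m p : ℕ} {G : Type*} [TopologicalSpace G]
  [ChartedSpace (EuclideanSpace ℝ (Fin n)) G] [Group G]
  {ι : G →* GL (Fin m) ℝ} {E : Module.Basis (Fin n) ℝ (lieAlg (n := n) ι)}
  {f : G → ℝ → EuclideanSpace ℝ (Fin p) → Matrix (Fin m) (Fin m) ℝ}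
  {r : G → EuclideanSpace ℝ (Fin p) → ℝ → ℝ}
  {σ : (Fin n → ℝ) → G} {T : ℝ} {g₀ : G} {θ θ' : EuclideanSpace ℝ (Fin p)} {γ h : ℝ → G}

section Algebra

variable {P : Type*} [NormedAddCommGroup P] [NormedSpace ℝ P]

/-- The dot product as a continuous bilinear map. -/
def dotCLM (n : ℕ) : (Fin n → ℝ) →L[ℝ] (Fin n → ℝ) →L[ℝ] ℝ :=
  (dotProductBilin ℝ ℝ : (Fin n → ℝ) →ₗ[ℝ] (Fin n → ℝ) →ₗ[ℝ] ℝ).toContinuousBilinearMap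

theorem dotCLM_apply (l x : Fin n → ℝ) : dotCLM n l x = l ⬝ᵥ x := rfl

theorem sum_apply_single_mul (φ : (Fin n → ℝ) →L[ℝ] ℝ) (y : Fin n → ℝ) :
    (fun i => φ (Pi.single i 1)) ⬝ᵥ y = φ y := by
  conv_rhs => rw [pi_eq_sum_univ' y]
  rw [map_sum]
  refine Finset.sum_congr rfl fun i _ => ?_
  rw [map_smul, smul_eq_mul, mul_comm]

/-- The linear operator `l ↦ -(D(·, 0))ᵀ l` of the adjoint equation. -/
def adjointOp (D : ((Fin n → ℝ) × P) →L[ℝ] (Fin n → ℝ)) : (Fin n → ℝ) →L[ℝ] (Fin n → ℝ) :=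
  ((Matrix.toLin' : Matrix (Fin n) (Fin n) ℝ ≃ₗ[ℝ] _) ≪≫ₗ LinearMap.toContinuousLinearMap)
    (Matrix.of fun i j => -D (Pi.single i 1, 0) j)

/-- The inhomogeneity `-R(·, 0)` of the adjoint equation. -/
def adjointVec (R : ((Fin n → ℝ) × P) →L[ℝ] ℝ) : Fin n → ℝ := fun i => -R (Pi.single i 1, 0)

theorem adjointOp_apply (D : ((Fin n → ℝ) × P) →L[ℝ] (Fin n → ℝ)) (l : Fin n → ℝ) (i : Fin n) :
    adjointOp D l i = -(l ⬝ᵥ D (Pi.single i 1, 0)) := by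
  change ((Matrix.of fun i j => -D (Pi.single i 1, 0) j) *ᵥ l) i = _
  simp [Matrix.mulVec, dotProduct, mul_comm]

/-- Paired with y, the adjoint right-hand side is minus the y-linear part of l · D + R; this is the
cancellation in the duality argument. -/
theorem adjoint_dotProduct (D : ((Fin n → ℝ) × P) →L[ℝ] (Fin n → ℝ))
    (R : ((Fin n → ℝ) × P) →L[ℝ] ℝ) (l y : Fin n → ℝ) :
    (adjointOp D l + adjointVec R) ⬝ᵥ y = -(l ⬝ᵥ D (y, 0) + R (y, 0)) := by
  have h := sum_apply_single_mul
    (-(((dotCLM n l).comp D + R).comp (ContinuousLinearMap.inl ℝ (Fin n → ℝ) P))) y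
  have h2 : adjointOp D l + adjointVec R = fun i =>
      (-(((dotCLM n l).comp D + R).comp (ContinuousLinearMap.inl ℝ (Fin n → ℝ) P)))
        (Pi.single i 1) := by
    funext i
    rw [Pi.add_apply, adjointOp_apply, adjointVec]
    simp [dotCLM_apply, add_comm]
  rw [h2, h]
  simp [dotCLM_apply]

theorem continuousOn_adjointOp {s : Set ℝ} {D : ℝ → ((Fin n → ℝ) × P) →L[ℝ] (Fin n → ℝ)}
    (hD : ContinuousOn D s) : ContinuousOn (fun t => adjointOp (D t)) s := by
  have h1 : Continuous ((Matrix.toLin' : Matrix (Fin n) (Fin n) ℝ ≃ₗ[ℝ] _) ≪≫ₗ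
      LinearMap.toContinuousLinearMap) :=
    LinearMap.continuous_of_finiteDimensional (LinearEquiv.toLinearMap _)
  refine h1.comp_continuousOn (continuousOn_pi.2 fun i => continuousOn_pi.2 fun j => ?_)
  exact ((continuous_apply j).comp_continuousOn (hD.clm_apply continuousOn_const)).neg

theorem continuousOn_adjointVec {s : Set ℝ} {R : ℝ → ((Fin n → ℝ) × P) →L[ℝ] ℝ}
    (hR : ContinuousOn R s) : ContinuousOn (fun t => adjointVec (R t)) s :=
  continuousOn_pi.2 fun _ => (hR.clm_apply continuousOn_const).neg

end Algebra

/-- Continuity along a state curve of the derivative in the local coordinates and the parameter. -/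
theorem IsStateSolution.continuousOn_fderiv [IsManifold (𝓡 n) 1 G]
    {W : Type*} [NormedAddCommGroup W] [NormedSpace ℝ W]
    {Φ : G × ℝ → ((Fin n → ℝ) × EuclideanSpace ℝ (Fin p)) → W}
    (hγ : IsStateSolution ι f T g₀ θ γ)
    (hΦ : ∀ z, ContMDiffAt
      (((𝓡 n).prod 𝓘(ℝ, ℝ)).prod 𝓘(ℝ, (Fin n → ℝ) × EuclideanSpace ℝ (Fin p)))
      𝓘(ℝ, W) 1 (Function.uncurry Φ) (z, (0, θ))) :
    ContinuousOn (fun t => fderiv ℝ (Φ (γ t, t)) (0, θ)) (Icc 0 T) := by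
  have h1 : Continuous fun z => fderiv ℝ (Φ z) (0, θ) := continuous_iff_continuousAt.2 fun z =>
    ContinuousAt.comp (f := fun z : G × ℝ => (z, ((0 : Fin n → ℝ), θ)))
      (hΦ z).continuousAt_fderiv_snd (by fun_prop)
  exact h1.comp_continuousOn (hγ.continuousOn.prodMk continuousOn_id)

theorem contMDiff_swap_args {N : Type*} [TopologicalSpace N]
    [ChartedSpace (EuclideanSpace ℝ (Fin n)) N] {r : N → EuclideanSpace ℝ (Fin p) → ℝ → ℝ}
    (hr1 : ContMDiff ((𝓡 n).prod (𝓘(ℝ, EuclideanSpace ℝ (Fin p)).prod 𝓘(ℝ, ℝ))) 𝓘(ℝ, ℝ) 1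
      (fun x : N × EuclideanSpace ℝ (Fin p) × ℝ => r x.1 x.2.1 x.2.2)) :
    ContMDiff ((𝓡 n).prod (𝓘(ℝ, ℝ).prod 𝓘(ℝ, EuclideanSpace ℝ (Fin p)))) 𝓘(ℝ, ℝ) 1
      (fun x : N × ℝ × EuclideanSpace ℝ (Fin p) => r x.1 x.2.2 x.2.1) :=
  ContMDiff.comp (g := fun x : N × EuclideanSpace ℝ (Fin p) × ℝ => r x.1 x.2.1 x.2.2) hr1
    (contMDiff_fst.prodMk ((contMDiff_snd.comp contMDiff_snd).prodMk
      (contMDiff_fst.comp contMDiff_snd)))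

variable (r) in
/-- The running cost in the local parametrization. -/
def relCost (σ : (Fin n → ℝ) → G) (z : G × ℝ) (u : (Fin n → ℝ) × EuclideanSpace ℝ (Fin p)) : ℝ :=
  r (z.1 * σ u.1) u.2 z.2

variable [LieGroup (𝓡 n) ∞ G]

theorem IsLocalParam.contMDiffAt_relCost (hσ : IsLocalParam E σ)
    (hr1 : ContMDiff ((𝓡 n).prod (𝓘(ℝ, EuclideanSpace ℝ (Fin p)).prod 𝓘(ℝ, ℝ))) 𝓘(ℝ, ℝ) 1
      (fun x : G × EuclideanSpace ℝ (Fin p) × ℝ => r x.1 x.2.1 x.2.2))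
    (z : G × ℝ) (θ : EuclideanSpace ℝ (Fin p)) :
    ContMDiffAt (((𝓡 n).prod 𝓘(ℝ, ℝ)).prod 𝓘(ℝ, (Fin n → ℝ) × EuclideanSpace ℝ (Fin p)))
      𝓘(ℝ, ℝ) 1 (Function.uncurry (relCost r σ)) (z, (0, θ)) :=
  hσ.contMDiffAt_comp (V := fun g t θ => r g θ t) (contMDiff_swap_args hr1) z θ

/-- The right-hand side of the adjoint equation in terms of the linearized relative dynamics. -/
theorem IsLocalParam.adjoint_rhs (hσ : IsLocalParam E σ) (hι : IsMatrixLieGroup (n := n) ι)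
    (hf : IsTangent (n := n) ι f)
    (hf1 : ContMDiff ((𝓡 n).prod (𝓘(ℝ, ℝ).prod 𝓘(ℝ, EuclideanSpace ℝ (Fin p))))
      𝓘(ℝ, Matrix (Fin m) (Fin m) ℝ) 1
      (fun x : G × ℝ × EuclideanSpace ℝ (Fin p) => f x.1 x.2.1 x.2.2))
    (hr1 : ContMDiff ((𝓡 n).prod (𝓘(ℝ, EuclideanSpace ℝ (Fin p)).prod 𝓘(ℝ, ℝ))) 𝓘(ℝ, ℝ) 1
      (fun x : G × EuclideanSpace ℝ (Fin p) × ℝ => r x.1 x.2.1 x.2.2))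
    (g : G) (t : ℝ) (θ : EuclideanSpace ℝ (Fin p)) (l : Fin n → ℝ) :
    -leftGradient hι E (fun g => l ⬝ᵥ (Lam E).symm (leftTriv hf g t θ) + r g θ t) g
      + (adMatrix hι E (leftTriv hf g t θ))ᵀ *ᵥ l =
    adjointOp (fderiv ℝ (relField E f σ θ (g, t)) (0, θ)) l
      + adjointVec (fderiv ℝ (relCost r σ (g, t)) (0, θ)) := by
  have hfc := contMDiff_coordField (E := E) hι hf1
  have hslice : ContMDiff (𝓡 n) ((𝓡 n).prod (𝓘(ℝ, ℝ).prod 𝓘(ℝ, EuclideanSpace ℝ (Fin p)))) 1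
      (fun g : G => (g, t, θ)) := contMDiff_id.prodMk contMDiff_const
  have h1 : ContMDiff (𝓡 n) 𝓘(ℝ, Fin n → ℝ) 1 (fun g => coordField E f g t θ) :=
    hfc.comp hslice
  have h2 : ContMDiff (𝓡 n) 𝓘(ℝ, ℝ) 1 (fun g => r g θ t) :=
    (contMDiff_swap_args hr1).comp hslice
  have h3 : ContMDiff (𝓡 n) 𝓘(ℝ, ℝ) 1 (fun g => l ⬝ᵥ coordField E f g t θ + r g θ t) :=
    ((dotCLM n l).contDiff.contMDiff.comp h1).add h2
  simp only [symm_leftTriv hf]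
  funext i
  have hV : MDifferentiableAt (𝓡 n) 𝓘(ℝ, ℝ)
      (fun g => l ⬝ᵥ coordField E f g t θ + r g θ t) g := (h3 g).mdifferentiableAt (by simp)
  have hΦ := (hσ.contMDiffAt_comp hfc (g, t) θ).differentiableAt_snd.hasFDerivAt
  have hR := (hσ.contMDiffAt_relCost hr1 (g, t) θ).differentiableAt_snd.hasFDerivAt
  have hin : HasFDerivAt (fun x : Fin n → ℝ => (x, θ))
      (ContinuousLinearMap.inl ℝ (Fin n → ℝ) (EuclideanSpace ℝ (Fin p))) 0 :=
    hasFDerivAt_prodMk_left 0 θ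
  have hd := (((dotCLM n l).hasFDerivAt.comp ((0 : Fin n → ℝ), θ) hΦ).add hR).comp 0 hin
  have hd' : HasFDerivAt (fun x => l ⬝ᵥ coordField E f (g * σ x) t θ + r (g * σ x) θ t) _ 0 := hd
  rw [Pi.add_apply, Pi.neg_apply, hσ.leftGradient_eq hι hV i, hd'.fderiv, Pi.add_apply,
    adjointOp_apply, adjointVec, hσ.fderiv_relField hι hf hf1]
  have had : ((adMatrix hι E (leftTriv hf g t θ))ᵀ *ᵥ l) i =
      l ⬝ᵥ (adMatrix hι E (leftTriv hf g t θ) *ᵥ Pi.single i 1) := by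
    rw [Matrix.mulVec_single_one, dotProduct_comm]
    rfl
  rw [had, dotProduct_sub]
  simp only [ContinuousLinearMap.comp_apply, add_apply,
    ContinuousLinearMap.inl_apply, dotCLM_apply]
  ring

/-- The integrand of the parameter gradient in terms of the linearized relative dynamics. -/
theorem IsLocalParam.gradientIntegrand_eq (hσ : IsLocalParam E σ)
    (hι : IsMatrixLieGroup (n := n) ι) (hf : IsTangent (n := n) ι f)
    (hf1 : ContMDiff ((𝓡 n).prod (𝓘(ℝ, ℝ).prod 𝓘(ℝ, EuclideanSpace ℝ (Fin p))))
      𝓘(ℝ, Matrix (Fin m) (Fin m) ℝ) 1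
      (fun x : G × ℝ × EuclideanSpace ℝ (Fin p) => f x.1 x.2.1 x.2.2))
    (hr1 : ContMDiff ((𝓡 n).prod (𝓘(ℝ, EuclideanSpace ℝ (Fin p)).prod 𝓘(ℝ, ℝ))) 𝓘(ℝ, ℝ) 1
      (fun x : G × EuclideanSpace ℝ (Fin p) × ℝ => r x.1 x.2.1 x.2.2))
    (θ : EuclideanSpace ℝ (Fin p)) (γ : ℝ → G) (l : ℝ → Fin n → ℝ) (t : ℝ) :
    gradientIntegrand E hf r θ γ l t =
      (InnerProductSpace.toDual ℝ (EuclideanSpace ℝ (Fin p))).symm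
        (((dotCLM n (l t)).comp (fderiv ℝ (relField E f σ θ (γ t, t)) (0, θ))
          + fderiv ℝ (relCost r σ (γ t, t)) (0, θ)).comp
          (ContinuousLinearMap.inr ℝ (Fin n → ℝ) (EuclideanSpace ℝ (Fin p)))) := by
  have hΦ := (hσ.contMDiffAt_comp (contMDiff_coordField (E := E) hι hf1) (γ t, t)
    θ).differentiableAt_snd.hasFDerivAt
  have hR := (hσ.contMDiffAt_relCost hr1 (γ t, t) θ).differentiableAt_snd.hasFDerivAt
  have hin : HasFDerivAt (fun x : EuclideanSpace ℝ (Fin p) => ((0 : Fin n → ℝ), x))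
      (ContinuousLinearMap.inr ℝ (Fin n → ℝ) (EuclideanSpace ℝ (Fin p))) θ :=
    hasFDerivAt_prodMk_right 0 θ
  have h1 := ((dotCLM n (l t)).hasFDerivAt.comp ((0 : Fin n → ℝ), θ) hΦ).comp θ hin
  have h2 := hR.comp θ hin
  have e1 : (fun θ' => l t ⬝ᵥ coordField E f (γ t) t θ') =
      ((dotCLM n (l t)) ∘ fun u : (Fin n → ℝ) × EuclideanSpace ℝ (Fin p) =>
        coordField E f (γ t * σ u.1) t u.2) ∘ fun x => (0, x) := by
    funext x
    simp [hσ.zero, dotCLM_apply]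
  have e2 : (fun θ' => r (γ t) θ' t) = relCost r σ (γ t, t) ∘ fun x => (0, x) := by
    funext x
    simp [hσ.zero, relCost]
  simp only [gradientIntegrand, symm_leftTriv hf, gradient]
  rw [e1, e2, h1.fderiv, h2.fderiv, ← map_add]
  congr 1
  ext1 δ
  -- In the direction (0, δ) the ad term vanishes, so the linearized relative field has the same
  -- θ-derivative as Λ⁻¹ξ.
  simp [hσ.fderiv_relField hι hf hf1]

end LieAdjoint

/-! ### Solvability of the system, duality and the gradient formula -/

namespace LieAdjoint

variable {n m p : ℕ} {G : Type*} [TopologicalSpace G]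
  [ChartedSpace (EuclideanSpace ℝ (Fin n)) G] [Group G]
  {ι : G →* GL (Fin m) ℝ} {E : Module.Basis (Fin n) ℝ (lieAlg (n := n) ι)}
  {f : G → ℝ → EuclideanSpace ℝ (Fin p) → Matrix (Fin m) (Fin m) ℝ}
  {F : G → EuclideanSpace ℝ (Fin p) → ℝ} {r : G → EuclideanSpace ℝ (Fin p) → ℝ → ℝ}
  {σ : (Fin n → ℝ) → G} {T : ℝ} {g₀ : G} {θ θ' : EuclideanSpace ℝ (Fin p)} {γ h : ℝ → G}
  {l : ℝ → Fin n → ℝ}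

/-- The running cost along a state solution is continuous in time. -/
theorem IsStateSolution.continuousOn_cost
    (hr1 : ContMDiff ((𝓡 n).prod (𝓘(ℝ, EuclideanSpace ℝ (Fin p)).prod 𝓘(ℝ, ℝ))) 𝓘(ℝ, ℝ) 1
      (fun x : G × EuclideanSpace ℝ (Fin p) × ℝ => r x.1 x.2.1 x.2.2))
    (hγ : IsStateSolution ι f T g₀ θ γ) : ContinuousOn (fun t => r (γ t) θ t) (Icc 0 T) :=
  hr1.continuous.comp_continuousOn
    (hγ.continuousOn.prodMk (continuousOn_const.prodMk continuousOn_id))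

theorem IsStateSolution.continuousOn_coordField
    (hfc : Continuous fun x : G × ℝ × EuclideanSpace ℝ (Fin p) => coordField E f x.1 x.2.1 x.2.2)
    (hγ : IsStateSolution ι f T g₀ θ γ) (θ' : EuclideanSpace ℝ (Fin p)) :
    ContinuousOn (fun t => coordField E f (γ t) t θ') (Icc 0 T) :=
  Continuous.comp_continuousOn
    (g := fun x : G × ℝ × EuclideanSpace ℝ (Fin p) => coordField E f x.1 x.2.1 x.2.2)
    (f := fun t => (γ t, t, θ')) hfc
    (hγ.continuousOn.prodMk (continuousOn_id.prodMk continuousOn_const))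

variable [LieGroup (𝓡 n) ∞ G]

/-- Along a state solution the adjoint equation has a solution. -/
theorem IsStateSolution.exists_isAdjointSolution (hι : IsMatrixLieGroup (n := n) ι)
    (hσ : IsLocalParam E σ) (hf : IsTangent (n := n) ι f)
    (hf1 : ContMDiff ((𝓡 n).prod (𝓘(ℝ, ℝ).prod 𝓘(ℝ, EuclideanSpace ℝ (Fin p))))
      𝓘(ℝ, Matrix (Fin m) (Fin m) ℝ) 1
      (fun x : G × ℝ × EuclideanSpace ℝ (Fin p) => f x.1 x.2.1 x.2.2))
    (hr1 : ContMDiff ((𝓡 n).prod (𝓘(ℝ, EuclideanSpace ℝ (Fin p)).prod 𝓘(ℝ, ℝ))) 𝓘(ℝ, ℝ) 1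
      (fun x : G × EuclideanSpace ℝ (Fin p) × ℝ => r x.1 x.2.1 x.2.2))
    (hT : 0 ≤ T) (hγ : IsStateSolution ι f T g₀ θ γ) :
    ∃ l : ℝ → Fin n → ℝ, IsAdjointSolution hι E hf F r T g₀ θ γ l := by
  have hD := hγ.continuousOn_fderiv fun z => hσ.contMDiffAt_relField hι hf1 z θ
  have hR := hγ.continuousOn_fderiv fun z => hσ.contMDiffAt_relCost hr1 z θ
  obtain ⟨l, hl0, hl⟩ := exists_solution_linear_ODE_backward hT (continuousOn_adjointOp hD)
    (continuousOn_adjointVec hR) (leftGradient hι E (fun g => F g θ) (γ T))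
  refine ⟨l, hγ, fun t ht => ?_, hl0⟩
  rw [hσ.adjoint_rhs hι hf hf1 hr1]
  exact hl t ht

theorem IsAdjointSolution.hasDerivWithinAt_adjointOp (hι : IsMatrixLieGroup (n := n) ι)
    (hσ : IsLocalParam E σ) (hf : IsTangent (n := n) ι f)
    (hf1 : ContMDiff ((𝓡 n).prod (𝓘(ℝ, ℝ).prod 𝓘(ℝ, EuclideanSpace ℝ (Fin p))))
      𝓘(ℝ, Matrix (Fin m) (Fin m) ℝ) 1
      (fun x : G × ℝ × EuclideanSpace ℝ (Fin p) => f x.1 x.2.1 x.2.2))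
    (hr1 : ContMDiff ((𝓡 n).prod (𝓘(ℝ, EuclideanSpace ℝ (Fin p)).prod 𝓘(ℝ, ℝ))) 𝓘(ℝ, ℝ) 1
      (fun x : G × EuclideanSpace ℝ (Fin p) × ℝ => r x.1 x.2.1 x.2.2))
    (hl : IsAdjointSolution hι E hf F r T g₀ θ γ l) {t : ℝ} (ht : t ∈ Icc 0 T) :
    HasDerivWithinAt l (adjointOp (fderiv ℝ (relField E f σ θ (γ t, t)) (0, θ)) (l t)
      + adjointVec (fderiv ℝ (relCost r σ (γ t, t)) (0, θ))) (Icc 0 T) t := by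
  rw [← hσ.adjoint_rhs hι hf hf1 hr1]
  exact hl.adjoint t ht

/-- The forward-backward system has at most one solution. -/
theorem IsAdjointSolution.eqOn (hι : IsMatrixLieGroup (n := n) ι)
    (hσ : IsLocalParam E σ) (hf : IsTangent (n := n) ι f)
    (hf1 : ContMDiff ((𝓡 n).prod (𝓘(ℝ, ℝ).prod 𝓘(ℝ, EuclideanSpace ℝ (Fin p))))
      𝓘(ℝ, Matrix (Fin m) (Fin m) ℝ) 1
      (fun x : G × ℝ × EuclideanSpace ℝ (Fin p) => f x.1 x.2.1 x.2.2))
    (hr1 : ContMDiff ((𝓡 n).prod (𝓘(ℝ, EuclideanSpace ℝ (Fin p)).prod 𝓘(ℝ, ℝ))) 𝓘(ℝ, ℝ) 1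
      (fun x : G × EuclideanSpace ℝ (Fin p) × ℝ => r x.1 x.2.1 x.2.2))
    (hT : 0 ≤ T) {γ' : ℝ → G} {l' : ℝ → Fin n → ℝ}
    (hl : IsAdjointSolution hι E hf F r T g₀ θ γ l)
    (hl' : IsAdjointSolution hι E hf F r T g₀ θ γ' l') :
    EqOn γ' γ (Icc 0 T) ∧ EqOn l' l (Icc 0 T) := by
  have hγ := hl.state.eqOn hι hσ hf hf1 hl'.state
  refine ⟨hγ, ?_⟩
  have hD := hl.state.continuousOn_fderiv fun z => hσ.contMDiffAt_relField hι hf1 z θ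
  refine eqOn_of_linear_ODE_backward (continuousOn_adjointOp hD)
    (b := fun t => adjointVec (fderiv ℝ (relCost r σ (γ t, t)) (0, θ))) (fun t ht => ?_)
    (fun t ht => hl.hasDerivWithinAt_adjointOp hι hσ hf hf1 hr1 ht) ?_
  · have := hl'.hasDerivWithinAt_adjointOp hι hσ hf hf1 hr1 ht
    rwa [hγ ht] at this
  · rw [hl.final, hl'.final, hγ ⟨hT, le_rfl⟩]

theorem IsAdjointSolution.continuousOn_gradientIntegrand (hι : IsMatrixLieGroup (n := n) ι)
    (hσ : IsLocalParam E σ) (hf : IsTangent (n := n) ι f)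
    (hf1 : ContMDiff ((𝓡 n).prod (𝓘(ℝ, ℝ).prod 𝓘(ℝ, EuclideanSpace ℝ (Fin p))))
      𝓘(ℝ, Matrix (Fin m) (Fin m) ℝ) 1
      (fun x : G × ℝ × EuclideanSpace ℝ (Fin p) => f x.1 x.2.1 x.2.2))
    (hr1 : ContMDiff ((𝓡 n).prod (𝓘(ℝ, EuclideanSpace ℝ (Fin p)).prod 𝓘(ℝ, ℝ))) 𝓘(ℝ, ℝ) 1
      (fun x : G × EuclideanSpace ℝ (Fin p) × ℝ => r x.1 x.2.1 x.2.2))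
    (hl : IsAdjointSolution hι E hf F r T g₀ θ γ l) :
    ContinuousOn (gradientIntegrand E hf r θ γ l) (Icc 0 T) := by
  have hD := hl.state.continuousOn_fderiv fun z => hσ.contMDiffAt_relField hι hf1 z θ
  have hR := hl.state.continuousOn_fderiv fun z => hσ.contMDiffAt_relCost hr1 z θ
  have hlc : ContinuousOn l (Icc 0 T) := fun t ht => (hl.adjoint t ht).continuousWithinAt
  have e : gradientIntegrand E hf r θ γ l = fun t => _ :=
    funext fun t => hσ.gradientIntegrand_eq hι hf hf1 hr1 θ γ l t
  rw [e]
  refine (LinearIsometryEquiv.continuous _).comp_continuousOn (ContinuousOn.clm_comp ?_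
    continuousOn_const)
  exact (((dotCLM n).continuous.comp_continuousOn hlc).clm_comp hD).add hR

theorem integral_add_sub_sub {a b : ℝ} {φ₁ φ₂ φ₃ φ₄ : ℝ → ℝ}
    (h₁ : IntervalIntegrable φ₁ MeasureTheory.volume a b)
    (h₂ : IntervalIntegrable φ₂ MeasureTheory.volume a b)
    (h₃ : IntervalIntegrable φ₃ MeasureTheory.volume a b)
    (h₄ : IntervalIntegrable φ₄ MeasureTheory.volume a b) :
    (∫ t in a..b, φ₁ t) + (∫ t in a..b, φ₂ t) - (∫ t in a..b, φ₃ t) - (∫ t in a..b, φ₄ t) =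
      ∫ t in a..b, (φ₁ t + φ₂ t - φ₃ t - φ₄ t) := by
  rw [← intervalIntegral.integral_add h₁ h₂, ← intervalIntegral.integral_sub (h₁.add h₂) h₃,
    ← intervalIntegral.integral_sub ((h₁.add h₂).sub h₃) h₄]

/-- The duality between the adjoint state and the relative motion of two state solutions, in
integrated form. -/
theorem IsAdjointSolution.integral_duality (hι : IsMatrixLieGroup (n := n) ι)
    (hσ : IsLocalParam E σ) (hf : IsTangent (n := n) ι f)
    (hf1 : ContMDiff ((𝓡 n).prod (𝓘(ℝ, ℝ).prod 𝓘(ℝ, EuclideanSpace ℝ (Fin p))))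
      𝓘(ℝ, Matrix (Fin m) (Fin m) ℝ) 1
      (fun x : G × ℝ × EuclideanSpace ℝ (Fin p) => f x.1 x.2.1 x.2.2))
    (hr1 : ContMDiff ((𝓡 n).prod (𝓘(ℝ, EuclideanSpace ℝ (Fin p)).prod 𝓘(ℝ, ℝ))) 𝓘(ℝ, ℝ) 1
      (fun x : G × EuclideanSpace ℝ (Fin p) × ℝ => r x.1 x.2.1 x.2.2))
    (hT : 0 ≤ T) (hl : IsAdjointSolution hι E hf F r T g₀ θ γ l)
    (hh : IsStateSolution ι f T g₀ θ' h)
    (hk : ∀ t ∈ Icc 0 T, σ (coordAtOne E ((γ t)⁻¹ * h t)) = (γ t)⁻¹ * h t) :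
    l T ⬝ᵥ coordAtOne E ((γ T)⁻¹ * h T) + (∫ t in (0 : ℝ)..T, r (h t) θ' t)
        - (∫ t in (0 : ℝ)..T, r (γ t) θ t)
        - inner ℝ (∫ t in (0 : ℝ)..T, gradientIntegrand E hf r θ γ l t) (θ' - θ) =
      ∫ t in (0 : ℝ)..T,
        (l t ⬝ᵥ (relField E f σ θ (γ t, t) (coordAtOne E ((γ t)⁻¹ * h t), θ')
            - relField E f σ θ (γ t, t) (0, θ)
            - fderiv ℝ (relField E f σ θ (γ t, t)) (0, θ)
              ((coordAtOne E ((γ t)⁻¹ * h t), θ') - (0, θ)))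
          + (relCost r σ (γ t, t) (coordAtOne E ((γ t)⁻¹ * h t), θ')
            - relCost r σ (γ t, t) (0, θ)
            - fderiv ℝ (relCost r σ (γ t, t)) (0, θ)
              ((coordAtOne E ((γ t)⁻¹ * h t), θ') - (0, θ)))) := by
  have hTG : IsTopologicalGroup G := topologicalGroup_of_lieGroup (𝓡 n) ∞
  have hD := hl.state.continuousOn_fderiv fun z => hσ.contMDiffAt_relField hι hf1 z θ
  have hR := hl.state.continuousOn_fderiv fun z => hσ.contMDiffAt_relCost hr1 z θ
  have hlc : ContinuousOn l (Icc 0 T) := fun t ht => (hl.adjoint t ht).continuousWithinAt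
  set y : ℝ → Fin n → ℝ := fun t => coordAtOne E ((γ t)⁻¹ * h t) with hy
  have hy' : ∀ t ∈ Icc 0 T, HasDerivWithinAt y (relField E f σ θ (γ t, t) (y t, θ')) (Icc 0 T) t :=
    fun t ht => hasDerivWithinAt_coordAtOne_of_param hf hl.state hh ht (hk t ht)
  have hyc : ContinuousOn y (Icc 0 T) := fun t ht => (hy' t ht).continuousWithinAt
  have hl' := fun t (ht : t ∈ Icc 0 T) => hl.hasDerivWithinAt_adjointOp hι hσ hf hf1 hr1 ht
  -- σ is known to be regular only near 0, so continuity is obtained by rewriting σ(y) as the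
  -- continuous curve γ⁻¹h.
  have hfield : ContinuousOn (fun t => relField E f σ θ (γ t, t) (y t, θ')) (Icc 0 T) := by
    have hfc := (contMDiff_coordField (E := E) hι hf1).continuous
    have hJ : Continuous (toMat ι) := hι.contMDiff.continuous
    have c1 := hh.continuousOn_coordField hfc θ'
    have c2 := hl.state.continuousOn_coordField hfc θ
    have c3 : ContinuousOn (fun t => toMat ι ((γ t)⁻¹ * h t)) (Icc 0 T) :=
      hJ.comp_continuousOn (continuousOn_inv_mul hl.state hh)
    have c4 := (matLam E).continuous.comp_continuousOn c1
    have c5 := (matLam E).continuous.comp_continuousOn c2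
    refine ((coordProj E).continuous.comp_continuousOn
      ((c3.mul c4).sub (c5.mul c3))).congr fun t ht => ?_
    simp only [relField, hy]
    rw [hk t ht, mul_inv_cancel_left]
    rfl
  have hq : ∀ t ∈ Icc 0 T, HasDerivWithinAt (fun t => dotCLM n (l t) (y t))
      (dotCLM n (l t) (relField E f σ θ (γ t, t) (y t, θ'))
        + dotCLM n (adjointOp (fderiv ℝ (relField E f σ θ (γ t, t)) (0, θ)) (l t)
          + adjointVec (fderiv ℝ (relCost r σ (γ t, t)) (0, θ))) (y t)) (Icc 0 T) t := by
    intro t ht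
    refine (((dotCLM n).hasFDerivAt.comp_hasDerivWithinAt t (hl' t ht)).clm_apply
      (hy' t ht)).congr_deriv ?_
    rw [add_comm]
    rfl
  have hqc : ContinuousOn (fun t => dotCLM n (l t) (relField E f σ θ (γ t, t) (y t, θ'))
        + dotCLM n (adjointOp (fderiv ℝ (relField E f σ θ (γ t, t)) (0, θ)) (l t)
          + adjointVec (fderiv ℝ (relCost r σ (γ t, t)) (0, θ))) (y t)) (Icc 0 T) :=
    (((dotCLM n).continuous.comp_continuousOn hlc).clm_apply hfield).add
      (((dotCLM n).continuous.comp_continuousOn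
        (((continuousOn_adjointOp hD).clm_apply hlc).add (continuousOn_adjointVec hR))).clm_apply
          hyc)
  have hgc := hl.continuousOn_gradientIntegrand hι hσ hf hf1 hr1
  have hrh := hh.continuousOn_cost hr1
  have hrγ := hl.state.continuousOn_cost hr1
  have hint : ∀ {φ : ℝ → ℝ}, ContinuousOn φ (Icc 0 T) →
      IntervalIntegrable φ MeasureTheory.volume 0 T := fun hφ =>
    ContinuousOn.intervalIntegrable (by rwa [uIcc_of_le hT])
  have hgint : IntervalIntegrable (gradientIntegrand E hf r θ γ l) MeasureTheory.volume 0 T :=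
    ContinuousOn.intervalIntegrable (by rwa [uIcc_of_le hT])
  -- Fundamental theorem of calculus for l · y; the lower boundary term vanishes because both
  -- solutions start at g₀.
  have hFTC := intervalIntegral.integral_eq_sub_of_hasDerivAt_of_le hT
    (fun t ht => (hq t ht).continuousWithinAt)
    (fun t ht => (hq t (Ioo_subset_Icc_self ht)).hasDerivAt (Icc_mem_nhds ht.1 ht.2)) (hint hqc)
  have hy0 : y 0 = 0 := by simp [hy, hl.state.init, hh.init, coordAtOne_one]
  rw [hy0, map_zero, sub_zero] at hFTC
  have hinner : inner ℝ (∫ t in (0 : ℝ)..T, gradientIntegrand E hf r θ γ l t) (θ' - θ) =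
      ∫ t in (0 : ℝ)..T, inner ℝ (gradientIntegrand E hf r θ γ l t) (θ' - θ) := by
    have := (innerSL ℝ (θ' - θ)).intervalIntegral_comp_comm hgint
    simp only [innerSL_apply_apply] at this
    rw [real_inner_comm, ← this]
    simp only [real_inner_comm]
  have hic : ContinuousOn (fun t => inner ℝ (gradientIntegrand E hf r θ γ l t) (θ' - θ))
      (Icc 0 T) := hgc.inner continuousOn_const
  rw [hinner, ← dotCLM_apply, ← hFTC,
    integral_add_sub_sub (hint hqc) (hint hrh) (hint hrγ) (hint hic)]
  refine intervalIntegral.integral_congr fun t ht => ?_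
  rw [uIcc_of_le hT] at ht
  have e1 : relCost r σ (γ t, t) (y t, θ') = r (h t) θ' t := by
    simp only [relCost, hy]
    rw [hk t ht, mul_inv_cancel_left]
  have e2 : relCost r σ (γ t, t) (0, θ) = r (γ t) θ t := by simp [relCost, hσ.zero]
  -- Splitting the increment into its y and θ parts: the adjoint equation absorbs the former, the
  -- gradient integrand the latter.
  have e3 : ((y t, θ') - ((0 : Fin n → ℝ), θ)) = (y t, 0) + (0, θ' - θ) := by simp
  have e4 : inner ℝ (gradientIntegrand E hf r θ γ l t) (θ' - θ) =
      l t ⬝ᵥ fderiv ℝ (relField E f σ θ (γ t, t)) (0, θ) (0, θ' - θ)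
        + fderiv ℝ (relCost r σ (γ t, t)) (0, θ) (0, θ' - θ) := by
    rw [hσ.gradientIntegrand_eq hι hf hf1 hr1, InnerProductSpace.toDual_symm_apply]
    rfl
  beta_reduce
  rw [e1, e2, e3, e4, hσ.relField_base, dotCLM_apply, dotCLM_apply, adjoint_dotProduct,
    map_add, map_add, sub_zero, dotProduct_sub, dotProduct_add]
  ring

/-- The gradient of the cost by the adjoint method. -/
theorem IsAdjointSolution.hasGradientAt_cost (hι : IsMatrixLieGroup (n := n) ι)
    (hσ : IsLocalParam E σ) (hf : IsTangent (n := n) ι f)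
    (hf1 : ContMDiff ((𝓡 n).prod (𝓘(ℝ, ℝ).prod 𝓘(ℝ, EuclideanSpace ℝ (Fin p))))
      𝓘(ℝ, Matrix (Fin m) (Fin m) ℝ) 1
      (fun x : G × ℝ × EuclideanSpace ℝ (Fin p) => f x.1 x.2.1 x.2.2))
    (hF1 : ContMDiff ((𝓡 n).prod 𝓘(ℝ, EuclideanSpace ℝ (Fin p))) 𝓘(ℝ, ℝ) 1
      (fun x : G × EuclideanSpace ℝ (Fin p) => F x.1 x.2))
    (hr1 : ContMDiff ((𝓡 n).prod (𝓘(ℝ, EuclideanSpace ℝ (Fin p)).prod 𝓘(ℝ, ℝ))) 𝓘(ℝ, ℝ) 1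
      (fun x : G × EuclideanSpace ℝ (Fin p) × ℝ => r x.1 x.2.1 x.2.2))
    (hT : 0 ≤ T) {Ψ : EuclideanSpace ℝ (Fin p) → ℝ → G → G}
    (hΨ : ∀ θ, IsStateSolution ι f T g₀ θ (fun t => Ψ θ t g₀))
    (hl : IsAdjointSolution hι E hf F r T g₀ θ (fun t => Ψ θ t g₀) l) :
    HasGradientAt (cost Ψ F r T g₀)
      (gradient (F (Ψ θ T g₀)) θ +
        ∫ t in (0 : ℝ)..T, gradientIntegrand E hf r θ (fun t => Ψ θ t g₀) l t) θ := by
  have hTI : T ∈ Icc 0 T := ⟨hT, le_rfl⟩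
  set γ : ℝ → G := fun t => Ψ θ t g₀ with hγdef
  have hK := isCompact_graph hl.state
  obtain ⟨C, hC0, hC⟩ := hl.state.exists_norm_coordAtOne_le hι hσ hf hf1
  have hlc : ContinuousOn l (Icc 0 T) := fun t ht => (hl.adjoint t ht).continuousWithinAt
  obtain ⟨B, hB⟩ := isCompact_Icc.exists_bound_of_continuousOn
    ((dotCLM n).continuous.comp_continuousOn hlc)
  have hB0 : 0 ≤ B := (norm_nonneg _).trans (hB T hTI)
  -- the terminal cost in the local parametrization
  have hFz : ContMDiff ((𝓡 n).prod (𝓘(ℝ, ℝ).prod 𝓘(ℝ, EuclideanSpace ℝ (Fin p)))) 𝓘(ℝ, ℝ) 1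
      (fun x : G × ℝ × EuclideanSpace ℝ (Fin p) => F x.1 x.2.2) :=
    ContMDiff.comp (g := fun x : G × EuclideanSpace ℝ (Fin p) => F x.1 x.2) hF1
      (contMDiff_fst.prodMk (contMDiff_snd.comp contMDiff_snd))
  have hFC := hσ.contMDiffAt_comp (V := fun g _ θ => F g θ) hFz (γ T, T) θ
  have hFd := hFC.differentiableAt_snd.hasFDerivAt
  set Fl : (Fin n → ℝ) × EuclideanSpace ℝ (Fin p) → ℝ := fun u => F (γ T * σ u.1) u.2 with hFl
  have hFd' : HasFDerivAt Fl (fderiv ℝ Fl (0, θ)) (0, θ) := hFd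
  have hFmd : MDifferentiableAt (𝓡 n) 𝓘(ℝ, ℝ) (fun g => F g θ) (γ T) :=
    (ContMDiffAt.comp (g := fun x : G × EuclideanSpace ℝ (Fin p) => F x.1 x.2) (γ T)
      (hF1 (γ T, θ)) (contMDiffAt_id.prodMk contMDiffAt_const)).mdifferentiableAt (by simp)
  have hlT : ∀ x, l T ⬝ᵥ x = fderiv ℝ Fl (0, θ) (x, 0) := by
    intro x
    have h1 : HasFDerivAt (fun x => F (γ T * σ x) θ) _ 0 :=
      HasFDerivAt.comp (f := fun x : Fin n → ℝ => (x, θ)) (0 : Fin n → ℝ) hFd'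
        (hasFDerivAt_prodMk_left 0 θ)
    have h2 := sum_apply_single_mul ((fderiv ℝ Fl (0, θ)).comp
      (ContinuousLinearMap.inl ℝ (Fin n → ℝ) (EuclideanSpace ℝ (Fin p)))) x
    have h3 : l T = fun i => ((fderiv ℝ Fl (0, θ)).comp
        (ContinuousLinearMap.inl ℝ (Fin n → ℝ) (EuclideanSpace ℝ (Fin p)))) (Pi.single i 1) := by
      funext i
      rw [hl.final, hσ.leftGradient_eq hι hFmd i, h1.fderiv]
    rw [h3, h2]
    rfl
  have hgrad : ∀ δ, inner ℝ (gradient (F (γ T)) θ) δ = fderiv ℝ Fl (0, θ) (0, δ) := by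
    intro δ
    have h1 : HasFDerivAt (Fl ∘ fun x => ((0 : Fin n → ℝ), x)) _ θ :=
      hFd'.comp θ (hasFDerivAt_prodMk_right 0 θ)
    have h2 : (Fl ∘ fun x => ((0 : Fin n → ℝ), x)) = F (γ T) := by
      funext x; simp [hFl, hσ.zero]
    rw [h2] at h1
    rw [gradient, InnerProductSpace.toDual_symm_apply, h1.fderiv]
    rfl
  rw [hasGradientAt_iff_isLittleO, Asymptotics.isLittleO_iff]
  intro c hc
  -- With η = ε(C + 1)‖θ' − θ‖, the integral contributes at most (Bη + η)T and the terminal cost η;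
  -- the total ((B + 1)T + 1)η is then c‖θ' − θ‖.
  set ε : ℝ := c / ((C + 1) * ((B + 1) * T + 1)) with hε
  have hden : 0 < (C + 1) * ((B + 1) * T + 1) := by positivity
  have hε0 : 0 < ε := div_pos hc hden
  have hev : ∀ᶠ u : (Fin n → ℝ) × EuclideanSpace ℝ (Fin p) in 𝓝 (0, θ),
      (∀ z ∈ (fun t => (γ t, t)) '' Icc 0 T,
        ‖relField E f σ θ z u - relField E f σ θ z (0, θ)
          - fderiv ℝ (relField E f σ θ z) (0, θ) (u - (0, θ))‖ ≤ ε * ‖u - (0, θ)‖) ∧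
      (∀ z ∈ (fun t => (γ t, t)) '' Icc 0 T,
        ‖relCost r σ z u - relCost r σ z (0, θ)
          - fderiv ℝ (relCost r σ z) (0, θ) (u - (0, θ))‖ ≤ ε * ‖u - (0, θ)‖) ∧
      ‖Fl u - Fl (0, θ) - fderiv ℝ Fl (0, θ) (u - (0, θ))‖ ≤ ε * ‖u - (0, θ)‖ :=
    (hK.eventually_norm_sub_fderiv_le (fun z _ => hσ.contMDiffAt_relField hι hf1 z θ) hε0).and
      ((hK.eventually_norm_sub_fderiv_le (fun z _ => hσ.contMDiffAt_relCost hr1 z θ) hε0).and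
        ((Asymptotics.isLittleO_iff.1 hFd'.isLittleO) hε0))
  obtain ⟨ρ, hρ, hball⟩ := Metric.eventually_nhds_iff_ball.1 hev
  have hnear : ∀ᶠ θ' in 𝓝 θ, (C + 1) * ‖θ' - θ‖ < ρ := by
    have hc : ContinuousAt (fun θ' => (C + 1) * ‖θ' - θ‖) θ := by fun_prop
    exact hc.eventually (gt_mem_nhds (by simpa using hρ))
  filter_upwards [hC, hnear] with θ' hCθ' hnear
  have hh := hΨ θ'
  have hclose := hCθ' _ hh
  have hdual := hl.integral_duality hι hσ hf hf1 hr1 hT hh fun t ht => (hclose t ht).1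
  set h : ℝ → G := fun t => Ψ θ' t g₀ with hhdef
  have hnorm : ∀ t ∈ Icc 0 T,
      ‖(coordAtOne E ((γ t)⁻¹ * h t), θ') - ((0 : Fin n → ℝ), θ)‖ ≤ (C + 1) * ‖θ' - θ‖ := by
    intro t ht
    rw [Prod.mk_sub_mk, sub_zero, Prod.norm_def, add_mul, one_mul]
    refine max_le ((hclose t ht).2.trans (le_add_of_nonneg_right (norm_nonneg _))) ?_
    exact le_add_of_nonneg_left (mul_nonneg hC0 (norm_nonneg _))
  have hrem : ∀ t ∈ Icc 0 T, _ := fun t ht =>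
    hball (coordAtOne E ((γ t)⁻¹ * h t), θ') (by
      rw [Metric.mem_ball, dist_eq_norm]
      exact (hnorm t ht).trans_lt hnear)
  set η : ℝ := ε * ((C + 1) * ‖θ' - θ‖) with hη
  have hle : ∀ t ∈ Icc 0 T,
      ε * ‖(coordAtOne E ((γ t)⁻¹ * h t), θ') - ((0 : Fin n → ℝ), θ)‖ ≤ η :=
    fun t ht => mul_le_mul_of_nonneg_left (hnorm t ht) hε0.le
  have hbound := intervalIntegral.norm_integral_le_of_norm_le_const (a := 0) (b := T)
    (C := B * η + η) (f := fun t =>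
        (l t ⬝ᵥ (relField E f σ θ (γ t, t) (coordAtOne E ((γ t)⁻¹ * h t), θ')
            - relField E f σ θ (γ t, t) (0, θ)
            - fderiv ℝ (relField E f σ θ (γ t, t)) (0, θ)
              ((coordAtOne E ((γ t)⁻¹ * h t), θ') - (0, θ)))
          + (relCost r σ (γ t, t) (coordAtOne E ((γ t)⁻¹ * h t), θ')
            - relCost r σ (γ t, t) (0, θ)
            - fderiv ℝ (relCost r σ (γ t, t)) (0, θ)
              ((coordAtOne E ((γ t)⁻¹ * h t), θ') - (0, θ))))) (by
      intro t ht
      rw [uIoc_of_le hT] at ht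
      have ht' := Ioc_subset_Icc_self ht
      have hz : (γ t, t) ∈ (fun t => (γ t, t)) '' Icc 0 T := ⟨t, ht', rfl⟩
      refine (norm_add_le _ _).trans (add_le_add ?_ (((hrem t ht').2.1 _ hz).trans (hle t ht')))
      exact (dotCLM n (l t)).le_of_opNorm_le_of_le (hB t ht')
        (((hrem t ht').1 _ hz).trans (hle t ht')))
  rw [← hdual, sub_zero, abs_of_nonneg hT] at hbound
  have hFrem := (hrem T hTI).2.2.trans (hle T hTI)
  have e1 : Fl (coordAtOne E ((γ T)⁻¹ * h T), θ') = F (h T) θ' := by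
    simp only [hFl]
    rw [(hclose T hTI).1, mul_inv_cancel_left]
  have e2 : Fl (0, θ) = F (γ T) θ := by simp [hFl, hσ.zero]
  have e3 : ((coordAtOne E ((γ T)⁻¹ * h T), θ') - ((0 : Fin n → ℝ), θ)) =
      (coordAtOne E ((γ T)⁻¹ * h T), 0) + (0, θ' - θ) := by simp
  rw [e1, e2, e3, map_add, ← hlT, ← hgrad] at hFrem
  -- Adding and subtracting l(T) · y(T) separates the terminal Taylor remainder from the left-hand
  -- side of the duality identity.
  have hfinal : cost Ψ F r T g₀ θ' - cost Ψ F r T g₀ θ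
      - inner ℝ (gradient (F (γ T)) θ
        + ∫ t in (0 : ℝ)..T, gradientIntegrand E hf r θ γ l t) (θ' - θ) =
      (F (h T) θ' - F (γ T) θ - (l T ⬝ᵥ coordAtOne E ((γ T)⁻¹ * h T)
        + inner ℝ (gradient (F (γ T)) θ) (θ' - θ)))
      + (l T ⬝ᵥ coordAtOne E ((γ T)⁻¹ * h T) + (∫ t in (0 : ℝ)..T, r (h t) θ' t)
        - (∫ t in (0 : ℝ)..T, r (γ t) θ t)
        - inner ℝ (∫ t in (0 : ℝ)..T, gradientIntegrand E hf r θ γ l t) (θ' - θ)) := by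
    rw [inner_add_left]
    simp only [cost, hγdef, hhdef]
    ring
  rw [hfinal]
  refine (norm_add_le _ _).trans ((add_le_add hFrem hbound).trans (le_of_eq ?_))
  rw [hη, hε]
  field_simp
  ring

end LieAdjoint

end

theorem theorem1 {n m p : ℕ} {G : Type*} [TopologicalSpace G]
    [ChartedSpace (EuclideanSpace ℝ (Fin n)) G] [Group G] [LieGroup (𝓡 n) ∞ G]
    (ι : G →* GL (Fin m) ℝ) (hι : LieAdjoint.IsMatrixLieGroup (n := n) ι)
    (E : Module.Basis (Fin n) ℝ (LieAdjoint.lieAlg (n := n) ι))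
    (f : G → ℝ → EuclideanSpace ℝ (Fin p) → Matrix (Fin m) (Fin m) ℝ)
    (hf : LieAdjoint.IsTangent (n := n) ι f)
    (hf1 : ContMDiff ((𝓡 n).prod (𝓘(ℝ, ℝ).prod 𝓘(ℝ, EuclideanSpace ℝ (Fin p))))
      𝓘(ℝ, Matrix (Fin m) (Fin m) ℝ) 1
      (fun x : G × ℝ × EuclideanSpace ℝ (Fin p) => f x.1 x.2.1 x.2.2))
    (F : G → EuclideanSpace ℝ (Fin p) → ℝ)
    (hF1 : ContMDiff ((𝓡 n).prod 𝓘(ℝ, EuclideanSpace ℝ (Fin p))) 𝓘(ℝ, ℝ) 1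
      (fun x : G × EuclideanSpace ℝ (Fin p) => F x.1 x.2))
    (r : G → EuclideanSpace ℝ (Fin p) → ℝ → ℝ)
    (hr1 : ContMDiff ((𝓡 n).prod (𝓘(ℝ, EuclideanSpace ℝ (Fin p)).prod 𝓘(ℝ, ℝ))) 𝓘(ℝ, ℝ) 1
      (fun x : G × EuclideanSpace ℝ (Fin p) × ℝ => r x.1 x.2.1 x.2.2))
    (T : ℝ) (hT : 0 ≤ T) (g₀ : G)
    (Ψ : EuclideanSpace ℝ (Fin p) → ℝ → G → G)
    (hΨ : ∀ θ, LieAdjoint.IsStateSolution ι f T g₀ θ (fun t => Ψ θ t g₀))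
    (θ : EuclideanSpace ℝ (Fin p)) :
    ∃ (γ : ℝ → G) (l : ℝ → Fin n → ℝ),
      LieAdjoint.IsAdjointSolution hι E hf F r T g₀ θ γ l ∧
      (∀ (γ' : ℝ → G) (l' : ℝ → Fin n → ℝ),
        LieAdjoint.IsAdjointSolution hι E hf F r T g₀ θ γ' l' →
          EqOn γ' γ (Icc 0 T) ∧ EqOn l' l (Icc 0 T)) ∧
      IntervalIntegrable (LieAdjoint.gradientIntegrand E hf r θ γ l) MeasureTheory.volume 0 T ∧
      HasGradientAt (LieAdjoint.cost Ψ F r T g₀)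
        (gradient (F (γ T)) θ +
          ∫ t in (0 : ℝ)..T, LieAdjoint.gradientIntegrand E hf r θ γ l t) θ := by
  obtain ⟨σ, hσ⟩ := LieAdjoint.exists_isLocalParam hι E
  obtain ⟨l, hl⟩ := (hΨ θ).exists_isAdjointSolution (F := F) hι hσ hf hf1 hr1 hT
  refine ⟨fun t => Ψ θ t g₀, l, hl, fun γ' l' h' => hl.eqOn hι hσ hf hf1 hr1 hT h', ?_,
    hl.hasGradientAt_cost hι hσ hf hf1 hF1 hr1 hT hΨ⟩
  refine ContinuousOn.intervalIntegrable ?_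
  rw [uIcc_of_le hT]
  exact hl.continuousOn_gradientIntegrand hι hσ hf hf1 hr1
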